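/- Let $P$ be a smooth finite-dimensional manifold (without boundary, Hausdorff, $\sigma$-compact) with a Poisson tensor $\pi$, and let $\pi:T^*P\to TP$ also denote the bundle map given by $\beta(\pi(\alpha))=\pi(\alpha,\beta)$. Suppose $\pi$ is regular: it has constant rank $2p$, and $q=\dim P-2p$. Let $\mathcal F$ be its symplectic foliation, with tangent bundle $T\mathcal F=\pi(T^*P)$, which is involutive; let $\mathcal X(\mathcal F)$ be the vector fields tangent to $\mathcal F$. Suppose that $\mathcal F$ is transversally oriented: there is a nowhere vanishing $q$-form $\nu$ on $P$ with $i_X\nu=0$ for all $X\in\mathcal X(\mathcal F)$ (a transverse orientation). Let $\mathcal A^1_{\mathcal F}$ be the space of smooth sections of $T^*\mathcal F$ (tangential $1$-forms), and let $H^1_{\mathcal F}(P)$ be the quotient of $\{\alpha\in\mathcal A^1_{\mathcal F}: d_{\mathcal F}\alpha=0\}$ by $\{d_{\mathcal F}f: f\in C^\infty(P)\}$, where $d_{\mathcal F}f(X)=X.f$ and $d_{\mathcal F}\alpha(X,Y)=X.\alpha(Y)-Y.\alpha(X)-\alpha([X,Y])$ for $X,Y\in\mathcal X(\mathcal F)$.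 Let $H^1_\pi(P)$ be the quotient of the space of vector fields $Q$ with $d_\pi Q=0$ by $\{d_\pi f: f\in C^\infty(P)\}$, where, for $1$-forms $\alpha,\beta$, $d_\pi f(\alpha)=\pi(\alpha).f$, $Q(\alpha)=\alpha(Q)$, $d_\pi Q(\alpha,\beta)=\pi(\alpha).Q(\beta)-\pi(\beta).Q(\alpha)-Q([\alpha,\beta]_\pi)$ and $[\alpha,\beta]_\pi=L_{\pi(\alpha)}\beta-L_{\pi(\beta)}\alpha-d(\pi(\alpha,\beta))$. For $\omega\in\mathcal A^1_{\mathcal F}$ let $\pi(\omega)$ be the vector field with $\beta(\pi(\omega))=\omega(\pi(\beta))$ for all covectors $\beta$. Then: 1. For every $\omega\in\mathcal A^1_{\mathcal F}$, the vector field $\pi(\omega)$ is annihilated by every $\beta\in\ker\pi$. The map $\omega\mapsto\pi(\omega)$ sends $d_{\mathcal F}$-closed forms to $d_\pi$-closed vector fields and induces a well-defined injective linear map $$\pi^*:H^1_{\mathcal F}(P)\hookrightarrow H^1_\pi(P),\qquad [\omega]\mapsto[\pi(\omega)].$$ 2. $\pi^*(\mathrm{mod}(\mathcal F))=\mathrm{mod}(P)$.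 Here the Reeb class $\mathrm{mod}(\mathcal F)\in H^1_{\mathcal F}(P)$ is the class of the closed tangential $1$-form $\alpha_{\mathcal F}$ defined by $L_X\nu=\alpha_{\mathcal F}(X)\,\nu$ for $X\in\mathcal X(\mathcal F)$, and it does not depend on the transverse orientation $\nu$. The modular class $\mathrm{mod}(P)\in H^1_\pi(P)$ is the class of the $d_\pi$-closed vector field $\phi_\mu$ defined by $L_{\pi(df)}\mu=\phi_\mu(f)\,\mu$ for $f\in C^\infty(P)$, where $\mu$ is a volume form on $P$; volume forms exist, and the class does not depend on $\mu$. -/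

import Mathlib

open scoped Manifold ContDiff

noncomputable section

namespace RegularPoisson

section VectorFieldsAndForms

variable (E : Type*) [NormedAddCommGroup E] [NormedSpace ℝ E]
  (M : Type*) [TopologicalSpace M] [ChartedSpace E M]

/-- The tangent space `T_x M` of a manifold without boundary modelled on `E`. -/
abbrev Tan (x : M) : Type _ := TangentSpace 𝓘(ℝ, E) x

/-- The cotangent space `T*_x M`. -/
abbrev Cot (x : M) : Type _ := Module.Dual ℝ (Tan E M x)

variable [IsManifold 𝓘(ℝ, E) ∞ M]

/-- Smooth vector fields on `M`, i.e. smooth sections of the tangent bundle. -/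
abbrev VF : Type _ := Cₛ^∞⟮𝓘(ℝ, E); E, (TangentSpace 𝓘(ℝ, E) : M → Type _)⟯

variable {E M}

/-- A real function on `M` is smooth. -/
abbrev SmoothFun (f : M → ℝ) : Prop := ContMDiff 𝓘(ℝ, E) 𝓘(ℝ, ℝ) ∞ f

variable (E) in
/-- The differential `df`, as a field of covectors. -/
def dfun (f : M → ℝ) (x : M) : Cot E M x := (mvfderiv 𝓘(ℝ, E) f x).toLinearMap

/-- The derivative `X.f` of a function along a vector field. -/
def VF.deriv (X : VF E M) (f : M → ℝ) (x : M) : ℝ := dfun E f x (X x)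

/-- The Lie bracket `[X, Y]` of two vector fields, so that `[X, Y].f = X.(Y.f) - Y.(X.f)`. -/
def VF.bracket [FiniteDimensional ℝ E] (X Y : VF E M) : VF E M where
  toFun := VectorField.mlieBracket 𝓘(ℝ, E) X Y
  contMDiff_toFun := by
    have := FiniteDimensional.complete ℝ E
    have : IsManifold 𝓘(ℝ, E) ((∞ : WithTop ℕ∞) + 1) M := ‹IsManifold 𝓘(ℝ, E) ∞ M›
    have : IsManifold 𝓘(ℝ, E) (minSmoothness ℝ 2) M := by
      simpa using IsManifold.of_le (I := 𝓘(ℝ, E)) (M := M) (n := ∞) (m := 2) (by decide)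
    have : IsManifold 𝓘(ℝ, E) (minSmoothness ℝ 3) M := by
      simpa using IsManifold.of_le (I := 𝓘(ℝ, E)) (M := M) (n := ∞) (m := 3) (by decide)
    intro x
    exact ContMDiffAt.mlieBracket_vectorField (m := ⊤) (n := ⊤) (X.contMDiff x) (Y.contMDiff x)
      (by simp)

/-- A field of `k`-covectors is smooth (a differential `k`-form) if its evaluation on smooth vector
fields is smooth. -/
def IsSmoothForm {k : ℕ} (η : ∀ x : M, Tan E M x [⋀^Fin k]→ₗ[ℝ] ℝ) : Prop :=
  ∀ Y : Fin k → VF E M, SmoothFun (E := E) fun x ↦ η x fun i ↦ Y i x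

/-- The same for `1`-forms, written as fields of covectors. -/
def IsSmoothOneForm (α : ∀ x : M, Cot E M x) : Prop :=
  ∀ Y : VF E M, SmoothFun (E := E) fun x ↦ α x (Y x)

/-- A `k`-form vanishes at no point. -/
def NowhereZero {k : ℕ} (η : ∀ x : M, Tan E M x [⋀^Fin k]→ₗ[ℝ] ℝ) : Prop :=
  ∀ x, η x ≠ 0

variable (E M) in
/-- The smooth differential `1`-forms on `M`. -/
abbrev OneForm : Type _ := {α : ∀ x : M, Cot E M x // IsSmoothOneForm α}

/-- The function `α(X)`, for a `1`-form `α` and a vector field `X`. -/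
def OneForm.eval (α : OneForm E M) (X : VF E M) (x : M) : ℝ := α.1 x (X x)

/-- The Lie derivative of a `k`-form:
`(L_X η)(Y₁, …, Y_k) = X.η(Y₁, …, Y_k) - ∑ᵢ η(Y₁, …, [X, Yᵢ], …, Y_k)`. -/
def lieDerivForm [FiniteDimensional ℝ E] {k : ℕ} (X : VF E M) (η : ∀ x : M, Tan E M x [⋀^Fin k]→ₗ[ℝ] ℝ)
    (Y : Fin k → VF E M) (x : M) : ℝ :=
  X.deriv (fun y ↦ η y fun i ↦ Y i y) x
    - ∑ i, η x (Function.update (fun j ↦ Y j x) i (X.bracket (Y i) x))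

/-- The Lie derivative of a `1`-form: `(L_X β)(Y) = X.β(Y) - β([X, Y])`. -/
def lieDerivOneForm [FiniteDimensional ℝ E] (X : VF E M) (β : OneForm E M) (Y : VF E M) (x : M) : ℝ :=
  X.deriv (β.eval Y) x - β.eval (X.bracket Y) x

/-- A volume form: a nowhere vanishing smooth form of top degree. -/
def IsVolumeForm (μ : ∀ x : M, Tan E M x [⋀^Fin (Module.finrank ℝ E)]→ₗ[ℝ] ℝ) : Prop :=
  IsSmoothForm μ ∧ NowhereZero μ

/-- The derivative of a smooth function along a smooth vector field is smooth. -/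
theorem VF.smooth_deriv (X : VF E M) {f : M → ℝ} (hf : SmoothFun (E := E) f) :
    SmoothFun (E := E) (X.deriv f) := by
  have h1 : ContMDiff 𝓘(ℝ, E) 𝓘(ℝ, ℝ).tangent ∞
      (fun x ↦ tangentMap 𝓘(ℝ, E) 𝓘(ℝ, ℝ) f ⟨x, X x⟩) :=
    (hf.contMDiff_tangentMap (m := ∞) (by simp)).comp X.contMDiff
  exact (contMDiff_snd_tangentBundle_modelSpace ℝ 𝓘(ℝ, ℝ)).comp h1

/-- The differential `df` of a smooth function, as a `1`-form. -/
def OneForm.ofFun (f : M → ℝ) (hf : SmoothFun (E := E) f) : OneForm E M :=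
  ⟨dfun E f, fun Y ↦ Y.smooth_deriv hf⟩

theorem VF.deriv_add (X : VF E M) {f g : M → ℝ} (hf : SmoothFun (E := E) f)
    (hg : SmoothFun (E := E) g) (x : M) :
    X.deriv (fun y ↦ f y + g y) x = X.deriv f x + X.deriv g x := by
  have := mvfderiv_add (I := 𝓘(ℝ, E)) (hf.mdifferentiable (by simp) x)
    (hg.mdifferentiable (by simp) x)
  exact DFunLike.congr_fun this (X x)

theorem VF.deriv_const_mul (X : VF E M) (c : ℝ) {f : M → ℝ} (hf : SmoothFun (E := E) f) (x : M) :
    X.deriv (fun y ↦ c * f y) x = c * X.deriv f x := by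
  have := mvfderiv_mul (I := 𝓘(ℝ, E)) (mdifferentiableAt_const (c := c))
    (hf.mdifferentiable (by simp) x)
  have := DFunLike.congr_fun this (X x)
  simpa [VF.deriv, dfun, mvfderiv_const, Pi.mul_def] using this

theorem VF.deriv_zero (X : VF E M) (x : M) : X.deriv (fun _ ↦ 0) x = 0 := by
  have := mvfderiv_const (I := 𝓘(ℝ, E)) (M := M) (0 : ℝ) (x := x)
  exact DFunLike.congr_fun this (X x)

theorem VF.bracket_add [FiniteDimensional ℝ E] (X Y Z : VF E M) (x : M) :
    X.bracket (Y + Z) x = X.bracket Y x + X.bracket Z x := by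
  have := FiniteDimensional.complete ℝ E
  have : IsManifold 𝓘(ℝ, E) 2 M :=
    IsManifold.of_le (I := 𝓘(ℝ, E)) (M := M) (n := ∞) (m := 2) (by decide)
  exact VectorField.mlieBracket_add_right (Y.contMDiff.mdifferentiable (by simp) x)
    (Z.contMDiff.mdifferentiable (by simp) x)

theorem VF.bracket_smul [FiniteDimensional ℝ E] (X Y : VF E M) (c : ℝ) (x : M) :
    X.bracket (c • Y) x = c • X.bracket Y x := by
  have := FiniteDimensional.complete ℝ E
  have : IsManifold 𝓘(ℝ, E) 2 M :=
    IsManifold.of_le (I := 𝓘(ℝ, E)) (M := M) (n := ∞) (m := 2) (by decide)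
  exact VectorField.mlieBracket_const_smul_right (Y.contMDiff.mdifferentiable (by simp) x)

/-- A field of tangent vectors is smooth as soon as it derives smooth functions to smooth
functions. -/
theorem contMDiff_of_deriv [FiniteDimensional ℝ E] [T2Space M] (X : ∀ x : M, Tan E M x)
    (h : ∀ f : M → ℝ, SmoothFun (E := E) f → SmoothFun (E := E) fun x ↦ dfun E f x (X x)) :
    ContMDiff 𝓘(ℝ, E) (𝓘(ℝ, E).prod 𝓘(ℝ, E)) ∞
      (fun x ↦ Bundle.TotalSpace.mk' E (E := (TangentSpace 𝓘(ℝ, E) : M → Type _)) x (X x)) := by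
  intro x₀
  rw [Bundle.contMDiffAt_section]
  set b := Module.finBasis ℝ E
  obtain ⟨ρ⟩ : Nonempty (SmoothBumpFunction 𝓘(ℝ, E) x₀) := inferInstance
  have key (i) : ContMDiffAt 𝓘(ℝ, E) 𝓘(ℝ, ℝ) ∞
      (fun x ↦ b.coord i ((trivializationAt E (TangentSpace 𝓘(ℝ, E)) x₀ ⟨x, X x⟩).2)) x₀ := by
    set l : E →L[ℝ] ℝ := (b.coord i).toContinuousLinearMap
    set g : M → ℝ := fun x ↦ l (extChartAt 𝓘(ℝ, E) x₀ x)
    have hg : ContMDiffOn 𝓘(ℝ, E) 𝓘(ℝ, ℝ) ∞ g (chartAt E x₀).source :=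
      l.contMDiff.comp_contMDiffOn contMDiffOn_extChartAt
    have hf := ρ.contMDiff_smul hg
    refine (h _ hf x₀).congr_of_eventuallyEq ?_
    filter_upwards [ρ.eventuallyEq_one.eventuallyEq_nhds,
      (chartAt E x₀).open_source.mem_nhds (mem_chart_source E x₀)] with x hx hxs
    have e1 : (fun y ↦ ρ y • g y) =ᶠ[nhds x] g := by
      filter_upwards [hx] with y hy
      simp [hy]
    have e2 : HasMFDerivAt 𝓘(ℝ, E) 𝓘(ℝ, ℝ) g x
        (l.comp (mfderiv 𝓘(ℝ, E) 𝓘(ℝ, E) (extChartAt 𝓘(ℝ, E) x₀) x)) :=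
      (l.hasMFDerivAt).comp x (mdifferentiableAt_extChartAt hxs).hasMFDerivAt
    have e3 : mfderiv 𝓘(ℝ, E) 𝓘(ℝ, ℝ) (fun y ↦ ρ y • g y) x
        = l.comp (mfderiv 𝓘(ℝ, E) 𝓘(ℝ, E) (extChartAt 𝓘(ℝ, E) x₀) x) :=
      (e2.congr_of_eventuallyEq e1).mfderiv
    have e4 : (trivializationAt E (TangentSpace 𝓘(ℝ, E)) x₀ ⟨x, X x⟩).2
        = mfderiv 𝓘(ℝ, E) 𝓘(ℝ, E) (extChartAt 𝓘(ℝ, E) x₀) x (X x) := by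
      have t1 := TangentBundle.continuousLinearMapAt_trivializationAt (I := 𝓘(ℝ, E)) hxs
      have t2 : (trivializationAt E (TangentSpace 𝓘(ℝ, E)) x₀ ⟨x, X x⟩).2
          = (trivializationAt E (TangentSpace 𝓘(ℝ, E)) x₀).continuousLinearMapAt ℝ x (X x) := by
        rw [Bundle.Trivialization.continuousLinearMapAt_apply,
          Bundle.Trivialization.linearMapAt_apply, if_pos (by simpa using hxs)]
      exact t2.trans (DFunLike.congr_fun t1 (X x))
    rw [e4]
    have e5 := DFunLike.congr_fun e3 (X x)
    exact e5.symm
  have := (b.equivFunL.symm : (Fin _ → ℝ) →L[ℝ] E).contMDiff.contMDiffAt.comp x₀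
    (contMDiffAt_pi_space.2 key) (n := ∞)
  refine this.congr_of_eventuallyEq (Filter.Eventually.of_forall fun x ↦ ?_)
  exact (b.equivFun.symm_apply_apply _).symm

end VectorFieldsAndForms

section Leafwise

/-! Leafwise cohomology and the Reeb class. A foliation is given by its tangent bundle, a field `D`
of subspaces of the tangent spaces. -/

variable {E : Type*} [NormedAddCommGroup E] [NormedSpace ℝ E] [FiniteDimensional ℝ E]
  {M : Type*} [TopologicalSpace M] [ChartedSpace E M] [IsManifold 𝓘(ℝ, E) ∞ M]
  (D : ∀ x : M, Submodule ℝ (Tan E M x))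

/-- The space `𝒳(𝓕)` of the vector fields tangent to the foliation. -/
def tangentFields : Submodule ℝ (VF E M) where
  carrier := {X | ∀ x, X x ∈ D x}
  add_mem' hX hY x := (D x).add_mem (hX x) (hY x)
  zero_mem' x := (D x).zero_mem
  smul_mem' c _ hX x := (D x).smul_mem c (hX x)

/-- Fields of linear forms on the spaces `D x`. -/
abbrev LeafCovectors : Type _ := ∀ x, D x →ₗ[ℝ] ℝ

variable {D} in
/-- The function `α(X)`, for a field `α` of linear forms on the spaces `D x` and a vector field
`X` tangent to `D`. -/
def leafEval (α : LeafCovectors D) (X : tangentFields D) (x : M) : ℝ :=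
  α x ⟨X.1 x, X.2 x⟩

/-- A field of linear forms on the spaces `D x` is smooth if `α(X)` is smooth for every
`X ∈ 𝒳(𝓕)`. -/
def smoothLeafCovectors : Submodule ℝ (LeafCovectors D) where
  carrier := {α | ∀ X : tangentFields D, SmoothFun (E := E) (leafEval α X)}
  add_mem' hα hβ X := (hα X).add (hβ X)
  zero_mem' _ := contMDiff_const
  smul_mem' _ _ hα X := contMDiff_const.mul (hα X)

/-- The space `𝒜¹_𝓕` of the tangential `1`-forms, the smooth sections of `T*𝓕`. -/
def TangForm : Type _ := smoothLeafCovectors D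

instance : AddCommGroup (TangForm D) := inferInstanceAs (AddCommGroup (smoothLeafCovectors D))

instance : Module ℝ (TangForm D) := inferInstanceAs (Module ℝ (smoothLeafCovectors D))

variable {D}

/-- The value at `x` of `d_𝓕 α(X, Y) = X.α(Y) - Y.α(X) - α([X, Y])`. The argument `h` holds
automatically when `D` is the tangent bundle of a foliation. -/
def leafD (α : TangForm D) (X Y : tangentFields D) (x : M) (h : X.1.bracket Y.1 x ∈ D x) : ℝ :=
  X.1.deriv (leafEval α.1 Y) x - Y.1.deriv (leafEval α.1 X) x - α.1 x ⟨X.1.bracket Y.1 x, h⟩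

variable (D)

/-- The tangential `1`-forms `α` with `d_𝓕 α = 0`. -/
def leafCocycles : Submodule ℝ (TangForm D) where
  carrier := {α | ∀ (X Y : tangentFields D) (x : M) (h : X.1.bracket Y.1 x ∈ D x),
    leafD α X Y x h = 0}
  add_mem' {α β} hα hβ X Y x h := by
    have e1 := VF.deriv_add X.1 (α.2 Y) (β.2 Y) x
    have e2 := VF.deriv_add Y.1 (α.2 X) (β.2 X) x
    have h1 := hα X Y x h
    have h2 := hβ X Y x h
    change X.1.deriv (fun y ↦ leafEval α.1 Y y + leafEval β.1 Y y) x
      - Y.1.deriv (fun y ↦ leafEval α.1 X y + leafEval β.1 X y) x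
      - (α.1 x ⟨_, h⟩ + β.1 x ⟨_, h⟩) = 0
    unfold leafD at h1 h2
    linarith
  zero_mem' X Y x h := by
    change X.1.deriv (fun _ ↦ 0) x - Y.1.deriv (fun _ ↦ 0) x - 0 = 0
    simp [VF.deriv_zero]
  smul_mem' c α hα X Y x h := by
    have e1 := VF.deriv_const_mul X.1 c (α.2 Y) x
    have e2 := VF.deriv_const_mul Y.1 c (α.2 X) x
    have h1 := hα X Y x h
    change X.1.deriv (fun y ↦ c * leafEval α.1 Y y) x
      - Y.1.deriv (fun y ↦ c * leafEval α.1 X y) x - c * α.1 x ⟨_, h⟩ = 0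
    unfold leafD at h1
    rw [e1, e2]
    linear_combination c * h1

/-- The tangential `1`-forms `d_𝓕 f`, where `d_𝓕 f(X) = X.f`, for smooth functions `f`. -/
def leafCoboundaries : Submodule ℝ (TangForm D) where
  carrier := {α | ∃ f : M → ℝ, SmoothFun (E := E) f ∧
    ∀ (X : tangentFields D) (x : M), leafEval α.1 X x = X.1.deriv f x}
  add_mem' := by
    rintro α β ⟨f, hf, h1⟩ ⟨g, hg, h2⟩
    refine ⟨fun y ↦ f y + g y, hf.add hg, fun X x ↦ ?_⟩
    rw [VF.deriv_add X.1 hf hg, ← h1, ← h2]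
    rfl
  zero_mem' := ⟨fun _ ↦ 0, contMDiff_const, fun X x ↦ by rw [VF.deriv_zero]; rfl⟩
  smul_mem' := by
    rintro c α ⟨f, hf, h1⟩
    refine ⟨fun y ↦ c * f y, contMDiff_const.mul hf, fun X x ↦ ?_⟩
    rw [VF.deriv_const_mul X.1 c hf, ← h1]
    rfl

/-- The first leafwise cohomology space `H¹_𝓕(M)`. -/
abbrev LeafH1 : Type _ := leafCocycles D ⧸ (leafCoboundaries D).submoduleOf (leafCocycles D)

variable {D} in
/-- The leafwise cohomology class of a `d_𝓕`-closed tangential `1`-form. -/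
def leafClass (α : leafCocycles D) : LeafH1 D := Submodule.Quotient.mk α

/-- `ν` is a transverse orientation of the foliation: a nowhere vanishing `q`-form, `q` being the
codimension, with `i_v ν = 0` for every `v` tangent to the foliation. -/
structure IsTransverseOrientation (q : ℕ) (ν : ∀ x : M, Tan E M x [⋀^Fin q]→ₗ[ℝ] ℝ) : Prop where
  smooth : IsSmoothForm ν
  nowhereZero : NowhereZero ν
  vanish : ∀ (x : M) (v : Fin q → Tan E M x) (i : Fin q), v i ∈ D x → ν x v = 0

/-- `α` is the Reeb form of `ν`: `L_X ν = α(X) ν` for every `X ∈ 𝒳(𝓕)`. -/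
def IsReebForm {q : ℕ} (ν : ∀ x : M, Tan E M x [⋀^Fin q]→ₗ[ℝ] ℝ) (α : TangForm D) : Prop :=
  ∀ (X : tangentFields D) (Y : Fin q → VF E M) (x : M),
    lieDerivForm X.1 ν Y x = leafEval α.1 X x * ν x fun i ↦ Y i x

/-- `c` is the Reeb class `mod(𝓕)`: there are transverse orientations, and each of them has a
closed Reeb form, whose class is `c`. -/
def IsReebClass (q : ℕ) (c : LeafH1 D) : Prop :=
  (∃ ν, IsTransverseOrientation D q ν) ∧
    ∀ ν, IsTransverseOrientation D q ν →
      ∃ α : leafCocycles D, IsReebForm D ν α.1 ∧ leafClass α = c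

end Leafwise

section Poisson

variable (E : Type*) [NormedAddCommGroup E] [NormedSpace ℝ E] [FiniteDimensional ℝ E]
  (M : Type*) [TopologicalSpace M] [ChartedSpace E M] [IsManifold 𝓘(ℝ, E) ∞ M]

/-- A Poisson tensor: a smooth bivector field, i.e. a field of alternating bilinear forms on the
cotangent spaces, for which the bracket `{f, g} = π(df, dg)` satisfies the Jacobi identity. -/
structure PoissonTensor where
  toFun : ∀ x : M, Cot E M x →ₗ[ℝ] Cot E M x →ₗ[ℝ] ℝ
  alt : ∀ (x : M) (a : Cot E M x), toFun x a a = 0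
  smooth : ∀ α β : OneForm E M, SmoothFun (E := E) fun x ↦ toFun x (α.1 x) (β.1 x)
  jacobi : ∀ f g h : M → ℝ, SmoothFun (E := E) f → SmoothFun (E := E) g → SmoothFun (E := E) h →
    ∀ x : M,
      toFun x (dfun E f x) (dfun E (fun y ↦ toFun y (dfun E g y) (dfun E h y)) x)
      + toFun x (dfun E g x) (dfun E (fun y ↦ toFun y (dfun E h y) (dfun E f y)) x)
      + toFun x (dfun E h x) (dfun E (fun y ↦ toFun y (dfun E f y) (dfun E g y)) x) = 0

variable {E M}

instance (x : M) : FiniteDimensional ℝ (Tan E M x) := inferInstanceAs (FiniteDimensional ℝ E)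

/-- The tangent vector `v` determined by `a(v) = ξ(a)` for all covectors `a`. -/
def ofBidual {x : M} : Module.Dual ℝ (Cot E M x) ≃ₗ[ℝ] Tan E M x :=
  (Module.evalEquiv ℝ (Tan E M x)).symm

theorem apply_ofBidual {x : M} (ξ : Module.Dual ℝ (Cot E M x)) (a : Cot E M x) :
    a (ofBidual ξ) = ξ a :=
  Module.apply_evalEquiv_symm_apply (R := ℝ) (M := Tan E M x) a ξ

namespace PoissonTensor

variable (π : PoissonTensor E M)

/-- The linear map `π : T*_x M → T_x M`, with `b(π(a)) = π(a, b)`. -/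
def sharp (x : M) : Cot E M x →ₗ[ℝ] Tan E M x := ofBidual.toLinearMap ∘ₗ π.toFun x

theorem apply_sharp {x : M} (a b : Cot E M x) : b (π.sharp x a) = π.toFun x a b :=
  apply_ofBidual _ _

/-- The tangent bundle of the symplectic foliation, the image of `π : T*M → TM`. -/
def dist (x : M) : Submodule ℝ (Tan E M x) := LinearMap.range (π.sharp x)

variable [T2Space M]

/-- The vector field `π(α)`. -/
def sharpField (α : OneForm E M) : VF E M where
  toFun x := π.sharp x (α.1 x)
  contMDiff_toFun := contMDiff_of_deriv _ fun f hf ↦ by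
    simp only [apply_sharp]
    exact π.smooth α (OneForm.ofFun f hf)

/-- `π(α)` as a vector field tangent to the symplectic foliation. -/
def sharpTangent (α : OneForm E M) : tangentFields π.dist :=
  ⟨π.sharpField α, fun x ↦ LinearMap.mem_range_self (π.sharp x) (α.1 x)⟩

/-- The `1`-form `[α, β]_π = L_{π(α)} β - L_{π(β)} α - d(π(α, β))`, evaluated on `Y`. -/
def koszul (α β : OneForm E M) (Y : VF E M) (x : M) : ℝ :=
  lieDerivOneForm (π.sharpField α) β Y x - lieDerivOneForm (π.sharpField β) α Y x
    - Y.deriv (fun y ↦ π.toFun y (α.1 y) (β.1 y)) x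

/-- `d_π Q(α, β) = π(α).Q(β) - π(β).Q(α) - Q([α, β]_π)` for a vector field `Q`, with
`Q(α) = α(Q)`. -/
def dPoisson (Q : VF E M) (α β : OneForm E M) (x : M) : ℝ :=
  (π.sharpField α).deriv (β.eval Q) x - (π.sharpField β).deriv (α.eval Q) x - π.koszul α β Q x

/-- The Poisson vector fields: the vector fields `Q` with `d_π Q = 0`. -/
def cocycles : Submodule ℝ (VF E M) where
  carrier := {Q | ∀ (α β : OneForm E M) (x : M), π.dPoisson Q α β x = 0}
  add_mem' {Q R} hQ hR α β x := by
    have d1 (X : VF E M) (γ : OneForm E M) :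
        X.deriv (γ.eval (Q + R)) x = X.deriv (γ.eval Q) x + X.deriv (γ.eval R) x := by
      refine Eq.trans ?_ (VF.deriv_add X (γ.2 Q) (γ.2 R) x)
      congr 1
      ext y
      exact map_add (γ.1 y) (Q y) (R y)
    have d2 (X : VF E M) (γ : OneForm E M) : γ.eval (X.bracket (Q + R)) x
        = γ.eval (X.bracket Q) x + γ.eval (X.bracket R) x := by
      unfold OneForm.eval
      rw [VF.bracket_add, map_add]
    have d3 (f : M → ℝ) : (Q + R).deriv f x = Q.deriv f x + R.deriv f x :=
      map_add (dfun E f x) (Q x) (R x)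
    have h1 := hQ α β x
    have h2 := hR α β x
    simp only [dPoisson, koszul, lieDerivOneForm, d1, d2, d3] at h1 h2 ⊢
    linarith
  zero_mem' α β x := by
    have d1 (X : VF E M) (γ : OneForm E M) : X.deriv (γ.eval 0) x = 0 := by
      rw [← VF.deriv_zero X x]
      congr 1
      ext y
      exact map_zero (γ.1 y)
    have d2 (X : VF E M) (γ : OneForm E M) : γ.eval (X.bracket 0) x = 0 := by
      have : X.bracket 0 x = 0 := congrFun (VectorField.mlieBracket_zero_right (W := X)) x
      unfold OneForm.eval
      rw [this, map_zero]
    have d3 (f : M → ℝ) : (0 : VF E M).deriv f x = 0 := map_zero (dfun E f x)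
    simp only [dPoisson, koszul, lieDerivOneForm, d1, d2, d3]
    simp
  smul_mem' c Q hQ α β x := by
    have d1 (X : VF E M) (γ : OneForm E M) :
        X.deriv (γ.eval (c • Q)) x = c * X.deriv (γ.eval Q) x := by
      refine Eq.trans ?_ (VF.deriv_const_mul X c (γ.2 Q) x)
      congr 1
      ext y
      exact map_smul (γ.1 y) c (Q y)
    have d2 (X : VF E M) (γ : OneForm E M) : γ.eval (X.bracket (c • Q)) x
        = c * γ.eval (X.bracket Q) x := by
      unfold OneForm.eval
      rw [VF.bracket_smul, map_smul, smul_eq_mul]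
    have d3 (f : M → ℝ) : (c • Q).deriv f x = c * Q.deriv f x :=
      map_smul (dfun E f x) c (Q x)
    have h1 := hQ α β x
    simp only [dPoisson, koszul, lieDerivOneForm, d1, d2, d3] at h1 ⊢
    linear_combination c * h1

/-- The vector fields `d_π f`, where `d_π f(α) = π(α).f`, for smooth functions `f`. -/
def coboundaries : Submodule ℝ (VF E M) where
  carrier := {Q | ∃ f : M → ℝ, SmoothFun (E := E) f ∧
    ∀ (α : OneForm E M) (x : M), α.eval Q x = (π.sharpField α).deriv f x}
  add_mem' := by
    rintro Q R ⟨f, hf, h1⟩ ⟨g, hg, h2⟩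
    refine ⟨fun y ↦ f y + g y, hf.add hg, fun α x ↦ ?_⟩
    rw [VF.deriv_add _ hf hg, ← h1, ← h2]
    exact map_add (α.1 x) (Q x) (R x)
  zero_mem' := ⟨fun _ ↦ 0, contMDiff_const, fun α x ↦ by
    rw [VF.deriv_zero]
    exact map_zero (α.1 x)⟩
  smul_mem' := by
    rintro c Q ⟨f, hf, h1⟩
    refine ⟨fun y ↦ c * f y, contMDiff_const.mul hf, fun α x ↦ ?_⟩
    rw [VF.deriv_const_mul _ c hf, ← h1]
    exact map_smul (α.1 x) c (Q x)

/-- The first Poisson cohomology space `H¹_π(P)`. -/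
abbrev H1 : Type _ := π.cocycles ⧸ π.coboundaries.submoduleOf π.cocycles

/-- The Poisson cohomology class of a Poisson vector field. -/
def cohomClass (Q : π.cocycles) : π.H1 := Submodule.Quotient.mk Q

/-- The map `π : 𝒜¹_𝓕 → 𝒳¹(P)` given by `π(α)(a) = α(π(a))` for covectors `a`. -/
def push : TangForm π.dist →ₗ[ℝ] VF E M where
  toFun α :=
    { toFun := fun x ↦ ofBidual (α.1 x ∘ₗ (π.sharp x).rangeRestrict)
      contMDiff_toFun := contMDiff_of_deriv _ fun f hf ↦ by
        simp only [apply_ofBidual]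
        exact α.2 (π.sharpTangent (OneForm.ofFun f hf)) }
  map_add' α β := by
    ext x
    exact map_add ofBidual (α.1 x ∘ₗ (π.sharp x).rangeRestrict)
      (β.1 x ∘ₗ (π.sharp x).rangeRestrict)
  map_smul' c α := by
    ext x
    exact map_smul ofBidual c (α.1 x ∘ₗ (π.sharp x).rangeRestrict)

theorem apply_push (α : TangForm π.dist) (x : M) (a : Cot E M x) :
    a (π.push α x) = α.1 x ⟨π.sharp x a, LinearMap.mem_range_self _ a⟩ :=
  apply_ofBidual _ _

/-- `φ` is the modular vector field of `π` with respect to `μ`: `φ.f = div_μ π(df)`, that is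
`L_{π(df)} μ = (φ.f) μ`, for every smooth function `f`. -/
def IsModularField (μ : ∀ x : M, Tan E M x [⋀^Fin (Module.finrank ℝ E)]→ₗ[ℝ] ℝ) (φ : VF E M) :
    Prop :=
  ∀ (f : M → ℝ) (hf : SmoothFun (E := E) f) (Y : Fin (Module.finrank ℝ E) → VF E M) (x : M),
    lieDerivForm (π.sharpField (OneForm.ofFun f hf)) μ Y x = φ.deriv f x * μ x fun i ↦ Y i x

/-- `c` is the modular class `mod(P)`: there are volume forms, and for each of them there is a
modular vector field, which is a Poisson vector field with class `c`. -/
def IsModularClass (c : π.H1) : Prop :=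
  (∃ μ : ∀ x : M, Tan E M x [⋀^Fin (Module.finrank ℝ E)]→ₗ[ℝ] ℝ, IsVolumeForm μ) ∧
    ∀ μ : ∀ x : M, Tan E M x [⋀^Fin (Module.finrank ℝ E)]→ₗ[ℝ] ℝ, IsVolumeForm μ →
      ∃ φ : π.cocycles, π.IsModularField μ φ.1 ∧ π.cohomClass φ = c

end PoissonTensor

end Poisson

end RegularPoisson

end

/-! The tangent bundle of the foliation is the image of π, so a tangential form ω is determined by
the function a ↦ ω(π(a)) on covectors, and this function is the vector field π(ω). Evaluated on
exact forms df and dg, d_π of π(ω) equals d_𝓕 ω(π(df), π(dg)), because [π(df), π(dg)] = π(d{f, g})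
by the Jacobi identity. Since d_π Q is tensorial and every covector is the differential of a
function at its point, closed forms go to closed fields (`push_mem_cocycles`). For the same reason
π(ω) = d_π f holds exactly when ω = d_𝓕 f (`push_mem_coboundaries_iff`), which gives both that the
map in cohomology is well defined and that it is injective.

For the classes, L_X ν is again killed by the foliation and has degree equal to the codimension, so
it is a multiple α(X) of ν (`exists_isReebForm`). The form α is closed because L_[X,Y] is the
commutator of L_X and L_Y. Let Pf denote the p-th power of π, viewed as an alternating 2p-form on
covectors; it is nonzero because π has rank 2p. The prescription μ(π(a₁), …, π(a₂ₚ), w) = Pf(a) ν(w)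
defines a volume form. Hamiltonian fields preserve π, hence Pf, so L_{π(df)} μ = α(π(df)) μ
(`exists_isVolumeForm`): the modular field of this μ is exactly π(α). Any other choice of ν or μ is
a multiple by a nowhere zero function g, which adds d log|g| and leaves the class unchanged.

Pointwise identities are reduced to convenient fields by tensoriality (`IsRegularDist.tensorial`,
`OneForm.tensorial`), and proportionality of top-degree forms comes from `KilledBy.mul_comm_apply`.
-/

noncomputable section

namespace RegularPoisson

/-! ### Calculus of functions, vector fields and brackets -/

section Calculus

variable {E : Type*} [NormedAddCommGroup E] [NormedSpace ℝ E]
  {M : Type*} [TopologicalSpace M] [ChartedSpace E M] [IsManifold 𝓘(ℝ, E) ∞ M]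

/-- The product `hX` of a smooth function and a vector field. -/
def VF.fmul (X : VF E M) {h : M → ℝ} (hh : SmoothFun (E := E) h) : VF E M :=
  ⟨h • ⇑X, hh.smul_section X.contMDiff⟩

theorem VF.fmul_apply (X : VF E M) {h : M → ℝ} (hh : SmoothFun (E := E) h) (x : M) :
    X.fmul hh x = h x • X x := rfl

theorem VF.deriv_fmul (X : VF E M) {h : M → ℝ} (hh : SmoothFun (E := E) h) (f : M → ℝ) (x : M) :
    (X.fmul hh).deriv f x = h x * X.deriv f x :=
  map_smul (dfun E f x) (h x) (X x)

theorem VF.add_deriv (X Y : VF E M) (f : M → ℝ) (x : M) :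
    (X + Y).deriv f x = X.deriv f x + Y.deriv f x :=
  map_add (dfun E f x) (X x) (Y x)

theorem VF.smul_deriv (c : ℝ) (X : VF E M) (f : M → ℝ) (x : M) :
    (c • X).deriv f x = c * X.deriv f x :=
  map_smul (dfun E f x) c (X x)

omit [IsManifold 𝓘(ℝ, E) ∞ M] in
theorem dfun_mul {f g : M → ℝ} (hf : SmoothFun (E := E) f) (hg : SmoothFun (E := E) g) (x : M) :
    dfun E (fun y ↦ f y * g y) x = f x • dfun E g x + g x • dfun E f x := by
  have := mvfderiv_mul (I := 𝓘(ℝ, E)) (hf.mdifferentiable (by simp) x)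
    (hg.mdifferentiable (by simp) x)
  ext v
  exact DFunLike.congr_fun this v

omit [IsManifold 𝓘(ℝ, E) ∞ M] in
theorem dfun_const (c : ℝ) (x : M) : dfun E (fun _ : M ↦ c) x = 0 := by
  have := mvfderiv_const (I := 𝓘(ℝ, E)) (M := M) c (x := x)
  ext v
  exact DFunLike.congr_fun this v

omit [IsManifold 𝓘(ℝ, E) ∞ M] in
theorem dfun_const_mul (c : ℝ) {f : M → ℝ} (hf : SmoothFun (E := E) f) (x : M) :
    dfun E (fun y ↦ c * f y) x = c • dfun E f x := by
  rw [dfun_mul contMDiff_const hf, dfun_const, smul_zero, add_zero]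

omit [IsManifold 𝓘(ℝ, E) ∞ M] in
theorem dfun_congr {f g : M → ℝ} {x : M} (h : f =ᶠ[nhds x] g) : dfun E f x = dfun E g x := by
  ext v
  have : mfderiv 𝓘(ℝ, E) 𝓘(ℝ, ℝ) f x = mfderiv 𝓘(ℝ, E) 𝓘(ℝ, ℝ) g x := h.mfderiv_eq
  exact DFunLike.congr_fun this v

omit [IsManifold 𝓘(ℝ, E) ∞ M] in
theorem smoothFun_sum {ι : Type*} {s : Finset ι} {f : ι → M → ℝ}
    (hf : ∀ i ∈ s, SmoothFun (E := E) (f i)) : SmoothFun (E := E) fun y ↦ ∑ i ∈ s, f i y :=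
  contMDiff_finsetSum hf

omit [IsManifold 𝓘(ℝ, E) ∞ M] in
theorem smoothFun_prod {ι : Type*} {s : Finset ι} {f : ι → M → ℝ}
    (hf : ∀ i ∈ s, SmoothFun (E := E) (f i)) : SmoothFun (E := E) fun y ↦ ∏ i ∈ s, f i y :=
  contMDiff_finsetProd hf

theorem VF.deriv_mul (X : VF E M) {f g : M → ℝ} (hf : SmoothFun (E := E) f)
    (hg : SmoothFun (E := E) g) (x : M) :
    X.deriv (fun y ↦ f y * g y) x = f x * X.deriv g x + g x * X.deriv f x := by
  simp [VF.deriv, dfun_mul hf hg]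

theorem VF.deriv_sub (X : VF E M) {f g : M → ℝ} (hf : SmoothFun (E := E) f)
    (hg : SmoothFun (E := E) g) (x : M) :
    X.deriv (fun y ↦ f y - g y) x = X.deriv f x - X.deriv g x := by
  have h := X.deriv_add (hf.sub hg) hg x
  simp only [sub_add_cancel] at h
  linarith

theorem VF.deriv_sum (X : VF E M) {ι : Type*} (s : Finset ι) {f : ι → M → ℝ}
    (hf : ∀ i, SmoothFun (E := E) (f i)) (x : M) :
    X.deriv (fun y ↦ ∑ i ∈ s, f i y) x = ∑ i ∈ s, X.deriv (f i) x := by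
  classical
  induction s using Finset.induction_on with
  | empty => simp [VF.deriv_zero]
  | insert a s ha ih =>
    simp only [Finset.sum_insert ha]
    rw [VF.deriv_add X (hf a) (smoothFun_sum fun i _ ↦ hf i), ih]

theorem VF.deriv_prod (X : VF E M) {ι : Type*} [DecidableEq ι] (s : Finset ι) {f : ι → M → ℝ}
    (hf : ∀ i, SmoothFun (E := E) (f i)) (x : M) :
    X.deriv (fun y ↦ ∏ i ∈ s, f i y) x
      = ∑ i ∈ s, X.deriv (f i) x * ∏ j ∈ s.erase i, f j x := by
  induction s using Finset.induction_on with
  | empty => simp [VF.deriv, dfun_const]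
  | insert a s ha ih =>
    simp only [Finset.prod_insert ha]
    rw [VF.deriv_mul X (hf a) (smoothFun_prod fun i _ ↦ hf i), ih, Finset.sum_insert ha,
      Finset.erase_insert ha, add_comm, mul_comm, Finset.mul_sum]
    congr 1
    refine Finset.sum_congr rfl fun i hi ↦ ?_
    have hai : a ≠ i := fun h ↦ ha (h ▸ hi)
    rw [Finset.erase_insert_of_ne hai, Finset.prod_insert (fun h ↦ ha (Finset.mem_of_mem_erase h))]
    ring

-- `Real.log` is the logarithm of the absolute value, so g need not be positive. This matters later,
-- where g compares two forms that may have opposite orientations.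
omit [IsManifold 𝓘(ℝ, E) ∞ M] in
theorem dfun_log {g : M → ℝ} (hg : SmoothFun (E := E) g) (x : M) (hx : g x ≠ 0) :
    dfun E (fun y ↦ Real.log (g y)) x = (g x)⁻¹ • dfun E g x := by
  ext v
  have h1 := (Real.hasDerivAt_log hx).hasFDerivAt
  have h2 := (h1.hasMFDerivAt.comp x (hg.mdifferentiable (by simp) x).hasMFDerivAt).mfderiv
  have h3 := DFunLike.congr_fun h2 v
  refine Eq.trans h3 ?_
  exact mul_comm _ _

omit [IsManifold 𝓘(ℝ, E) ∞ M] in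
theorem smoothFun_log {g : M → ℝ} (hg : SmoothFun (E := E) g) (h0 : ∀ x, g x ≠ 0) :
    SmoothFun (E := E) fun y ↦ Real.log (g y) := fun x ↦
  (Real.contDiffAt_log.2 (h0 x)).contMDiffAt.comp x (hg x)

theorem VF.deriv_log (X : VF E M) {g : M → ℝ} (hg : SmoothFun (E := E) g) (x : M)
    (hx : g x ≠ 0) : X.deriv (fun y ↦ Real.log (g y)) x * g x = X.deriv g x := by
  rw [VF.deriv, dfun_log hg x hx, VF.deriv, LinearMap.smul_apply, smul_eq_mul]
  field_simp

variable [FiniteDimensional ℝ E]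

theorem VF.bracket_swap (X Y : VF E M) (x : M) : X.bracket Y x = -Y.bracket X x :=
  VectorField.mlieBracket_swap_apply

theorem VF.bracket_fmul (X Y : VF E M) {h : M → ℝ} (hh : SmoothFun (E := E) h) (x : M) :
    X.bracket (Y.fmul hh) x = X.deriv h x • Y x + h x • X.bracket Y x := by
  have := FiniteDimensional.complete ℝ E
  have : IsManifold 𝓘(ℝ, E) 2 M :=
    IsManifold.of_le (I := 𝓘(ℝ, E)) (M := M) (n := ∞) (m := 2) (by decide)
  exact VectorField.mlieBracket_smul_right (hh.mdifferentiable (by simp) x)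
    (Y.contMDiff.mdifferentiable (by simp) x)

theorem VF.fmul_bracket (X Y : VF E M) {h : M → ℝ} (hh : SmoothFun (E := E) h) (x : M) :
    (X.fmul hh).bracket Y x = -(Y.deriv h x • X x) + h x • X.bracket Y x := by
  rw [VF.bracket_swap, VF.bracket_fmul, VF.bracket_swap Y X]
  module

theorem VF.add_bracket (X Y Z : VF E M) (x : M) :
    (X + Y).bracket Z x = X.bracket Z x + Y.bracket Z x := by
  rw [VF.bracket_swap, VF.bracket_add, VF.bracket_swap Z X, VF.bracket_swap Z Y]
  module

theorem VF.smul_bracket (c : ℝ) (X Z : VF E M) (x : M) :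
    (c • X).bracket Z x = c • X.bracket Z x := by
  rw [VF.bracket_swap, VF.bracket_smul, VF.bracket_swap Z X]
  module

theorem VF.leibniz_bracket (X Y Z : VF E M) :
    X.bracket (Y.bracket Z) = (X.bracket Y).bracket Z + Y.bracket (X.bracket Z) := by
  have := FiniteDimensional.complete ℝ E
  have : IsManifold 𝓘(ℝ, E) (minSmoothness ℝ 3) M := by
    simpa using IsManifold.of_le (I := 𝓘(ℝ, E)) (M := M) (n := ∞) (m := 3) (by decide)
  ext x
  refine VectorField.leibniz_identity_mlieBracket_apply
    ((X.contMDiff x).of_le ?_) ((Y.contMDiff x).of_le ?_) ((Z.contMDiff x).of_le ?_) <;>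
  · simp only [minSmoothness_of_isRCLikeNormedField]
    decide

theorem VF.bracket_congr_right (X : VF E M) {Y Z : VF E M} (h : ∀ y, Y y = Z y) (x : M) :
    X.bracket Y x = X.bracket Z x := by
  have : Y = Z := by ext y; exact h y
  rw [this]

/-- A tangent vector extends to a vector field. -/
theorem exists_VF_apply_eq [T2Space M] (x : M) (v : Tan E M x) : ∃ X : VF E M, X x = v := by
  obtain ⟨ρ⟩ : Nonempty (SmoothBumpFunction 𝓘(ℝ, E) x) := inferInstance
  set t := trivializationAt E (TangentSpace 𝓘(ℝ, E) : M → Type _) x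
  let s : ∀ y : M, Tan E M y := fun y ↦ t.symm y (t ⟨x, v⟩).2
  have hs : ContMDiffOn 𝓘(ℝ, E) (𝓘(ℝ, E).prod 𝓘(ℝ, E)) ∞
      (fun y ↦ Bundle.TotalSpace.mk' E (E := (TangentSpace 𝓘(ℝ, E) : M → Type _)) y (s y))
      (chartAt E x).source := by
    intro y hy
    have hy' : y ∈ t.baseSet := by simpa [t] using hy
    rw [t.contMDiffWithinAt_section _ hy']
    refine (contMDiffWithinAt_const (c := (t ⟨x, v⟩).2)).congr_of_mem (fun z hz ↦ ?_) hy
    have hz' : z ∈ t.baseSet := by simpa [t] using hz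
    exact (Prod.ext_iff.1 (t.apply_mk_symm hz' (t ⟨x, v⟩).2)).2
  refine ⟨⟨⇑ρ • s, ContMDiffOn.smul_section_of_tsupport (ρ.contMDiff.contMDiffOn)
    (chartAt E x).open_source ρ.tsupport_subset_chartAt_source hs⟩, ?_⟩
  change ρ x • s x = v
  rw [ρ.eq_one, one_smul]
  exact t.symm_apply_apply_mk (FiberBundle.mem_baseSet_trivializationAt' x) v

/-- `[X, Y].f = X.(Y.f) - Y.(X.f)`. -/
theorem VF.bracket_deriv [T2Space M] (X Y : VF E M) {f : M → ℝ} (hf : SmoothFun (E := E) f)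
    (x : M) : (X.bracket Y).deriv f x = X.deriv (Y.deriv f) x - Y.deriv (X.deriv f) x := by
  by_cases hE : ∀ v : Tan E M x, v = 0
  · simp [VF.deriv, hE (X.bracket Y x), hE (X x), hE (Y x)]
  push Not at hE
  obtain ⟨w, hw⟩ := hE
  obtain ⟨W, rfl⟩ := exists_VF_apply_eq x w
  -- The Jacobi identity for X, Y, fW is compared with the one for X, Y, W. What remains is a
  -- multiple of W, whose coefficient is the difference of the two sides of the claim; W is nonzero
  -- at x.
  have h1 := DFunLike.congr_fun (X.leibniz_bracket Y (W.fmul hf)) x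
  have e (X Y : VF E M) : X.bracket (Y.bracket (W.fmul hf)) x
      = X.bracket (W.fmul (Y.smooth_deriv hf)) x + X.bracket ((Y.bracket W).fmul hf) x := by
    rw [← VF.bracket_add]
    exact X.bracket_congr_right (fun y ↦ Y.bracket_fmul W hf y) x
  have h2 := DFunLike.congr_fun (X.leibniz_bracket Y W) x
  change _ = (X.bracket Y).bracket W x + _ at h2
  change _ = (X.bracket Y).bracket (W.fmul hf) x + Y.bracket (X.bracket (W.fmul hf)) x at h1
  simp only [e, VF.bracket_fmul, h2] at h1
  have h3 : ((X.bracket Y).deriv f x - (X.deriv (Y.deriv f) x - Y.deriv (X.deriv f) x)) • W x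
      = 0 := by
    rw [← sub_eq_zero] at h1
    rw [← neg_eq_zero, ← h1]
    module
  exact sub_eq_zero.1 ((smul_eq_zero.1 h3).resolve_right hw)

/-- A covector is the differential of a smooth function. -/
theorem exists_smoothFun_dfun_eq [T2Space M] (x : M) (a : Cot E M x) :
    ∃ f : M → ℝ, SmoothFun (E := E) f ∧ dfun E f x = a := by
  obtain ⟨ρ⟩ : Nonempty (SmoothBumpFunction 𝓘(ℝ, E) x) := inferInstance
  have hsrc : x ∈ (chartAt E x).source := mem_chart_source E x
  set D := mfderiv 𝓘(ℝ, E) 𝓘(ℝ, E) (extChartAt 𝓘(ℝ, E) x) x with hD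
  have hinv : D.IsInvertible := isInvertible_mfderiv_extChartAt (mem_extChartAt_source x)
  let l : E →L[ℝ] ℝ := LinearMap.toContinuousLinearMap (a ∘ₗ D.inverse.toLinearMap)
  let g : M → ℝ := fun y ↦ l (extChartAt 𝓘(ℝ, E) x y)
  have hg : ContMDiffOn 𝓘(ℝ, E) 𝓘(ℝ, ℝ) ∞ g (chartAt E x).source :=
    l.contMDiff.comp_contMDiffOn contMDiffOn_extChartAt
  refine ⟨fun y ↦ ρ y • g y, ρ.contMDiff_smul hg, ?_⟩
  have e1 : (fun y ↦ ρ y • g y) =ᶠ[nhds x] g := by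
    filter_upwards [ρ.eventuallyEq_one] with y hy
    simp [hy]
  have e2 : HasMFDerivAt 𝓘(ℝ, E) 𝓘(ℝ, ℝ) g x (l.comp D) :=
    (l.hasMFDerivAt).comp x (mdifferentiableAt_extChartAt hsrc).hasMFDerivAt
  rw [dfun_congr e1]
  ext v
  refine (DFunLike.congr_fun e2.mfderiv v).trans ?_
  change a (D.inverse (D v)) = a v
  congr 1
  obtain ⟨D', hD'⟩ := hinv
  rw [← hD', ContinuousLinearMap.inverse_equiv]
  exact D'.symm_apply_apply v

end Calculus

/-! ### Alternating forms killed by a subspace -/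

section LinearAlgebra

variable {V : Type*} [AddCommGroup V] [Module ℝ V] {ι : Type*} [Fintype ι] [DecidableEq ι]

/-- `g` is killed by the vectors of `K`. -/
def KilledBy (K : Submodule ℝ V) (g : V [⋀^ι]→ₗ[ℝ] ℝ) : Prop :=
  ∀ (v : ι → V) (i : ι), v i ∈ K → g v = 0

/-- The arguments are exchanged one at a time; each exchange changes g by a value with an argument
in K. Thus g descends to the quotient by K. -/
theorem KilledBy.eq_of_sub_mem {K : Submodule ℝ V} {g : V [⋀^ι]→ₗ[ℝ] ℝ} (hg : KilledBy K g)
    {u v : ι → V} (h : ∀ i, u i - v i ∈ K) : g u = g v := by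
  have key (s : Finset ι) : g (s.piecewise u v) = g v := by
    induction s using Finset.induction_on with
    | empty => simp
    | insert a s ha ih =>
      rw [Finset.piecewise_insert, ← ih, ← sub_eq_zero]
      have h2 : s.piecewise u v = Function.update (s.piecewise u v) a (v a) := by
        conv_lhs => rw [← Function.update_eq_self a (s.piecewise u v)]
        rw [Finset.piecewise_eq_of_notMem _ _ _ ha]
      conv_lhs => rw [h2, Function.update_idem, ← g.map_update_sub]
      exact hg _ a (by simpa using h a)
  simpa using key Finset.univ

/-- Along combinations of v₀ the form g pulls back to a top-degree form on ℝ^ι, hence to a multiple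
of the determinant. -/
theorem KilledBy.apply_eq_det_mul {K : Submodule ℝ V} {g : V [⋀^ι]→ₗ[ℝ] ℝ} (hg : KilledBy K g)
    {v v₀ : ι → V} {A : Matrix ι ι ℝ} (h : ∀ i, v i - ∑ j, A i j • v₀ j ∈ K) :
    g v = A.det * g v₀ := by
  rw [hg.eq_of_sub_mem h]
  let L : (ι → ℝ) →ₗ[ℝ] V := Fintype.linearCombination ℝ v₀
  have h1 := (g.compLinearMap L).eq_smul_basis_det (Pi.basisFun ℝ ι)
  have h2 := DFunLike.congr_fun h1 (fun i ↦ A i)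
  have h3 : (g.compLinearMap L) (Pi.basisFun ℝ ι) = g v₀ := by
    simp only [AlternatingMap.compLinearMap_apply]
    congr 1
    ext i
    simp [L, Fintype.linearCombination_apply_single]
  rw [h3] at h2
  rw [mul_comm]
  refine Eq.trans ?_ (h2.trans ?_)
  · rfl
  · rw [AlternatingMap.smul_apply, smul_eq_mul]
    exact congrArg (g v₀ * ·) (Pi.basisFun_det_apply (fun i ↦ A i))

/-- Put into slot i of v₀, the combination contributes only c i * g v₀, all other terms having a
repeated argument. -/
theorem KilledBy.coeff_eq_zero {K : Submodule ℝ V} {g : V [⋀^ι]→ₗ[ℝ] ℝ} (hg : KilledBy K g)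
    {v₀ : ι → V} (h0 : g v₀ ≠ 0) {c : ι → ℝ} (hc : ∑ j, c j • v₀ j ∈ K) (i : ι) : c i = 0 := by
  have h1 : g (Function.update v₀ i (∑ j, c j • v₀ j)) = 0 := hg _ i (by simpa using hc)
  rw [g.map_update_sum, Finset.sum_eq_single i] at h1
  · rw [g.map_update_smul, Function.update_eq_self, smul_eq_mul] at h1
    exact (mul_eq_zero.1 h1).resolve_right h0
  · intro j _ hj
    rw [g.map_update_smul, g.map_update_self _ hj.symm, smul_zero]
  · simp

theorem KilledBy.linearIndependent_mkQ {K : Submodule ℝ V} {g : V [⋀^ι]→ₗ[ℝ] ℝ}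
    (hg : KilledBy K g) {v₀ : ι → V} (h0 : g v₀ ≠ 0) :
    LinearIndependent ℝ (fun i ↦ K.mkQ (v₀ i)) := by
  rw [Fintype.linearIndependent_iff]
  intro c hc
  refine hg.coeff_eq_zero h0 ?_
  rw [← Submodule.ker_mkQ K, LinearMap.mem_ker, map_sum]
  simpa using hc

/-- Modulo `K`, all vectors are combinations of a family on which `g` does not vanish. -/
theorem KilledBy.exists_coeff [FiniteDimensional ℝ V] {K : Submodule ℝ V} {g : V [⋀^ι]→ₗ[ℝ] ℝ}
    (hg : KilledBy K g) (hK : Module.finrank ℝ K + Fintype.card ι = Module.finrank ℝ V)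
    {v₀ : ι → V} (h0 : g v₀ ≠ 0) (v : V) : ∃ c : ι → ℝ, v - ∑ j, c j • v₀ j ∈ K := by
  have hcard : Fintype.card ι = Module.finrank ℝ (V ⧸ K) := by
    have := Submodule.finrank_quotient_add_finrank K
    omega
  have hspan := (hg.linearIndependent_mkQ h0).span_eq_top_of_card_eq_finrank' hcard
  obtain ⟨c, hc⟩ := (Submodule.mem_span_range_iff_exists_fun ℝ).1
    (hspan ▸ Submodule.mem_top : K.mkQ v ∈ _)
  refine ⟨c, ?_⟩
  rw [← Submodule.ker_mkQ K, LinearMap.mem_ker, map_sub, map_sum, ← hc]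
  simp

/-- Two alternating forms of degree `codim K` killed by `K` are proportional. -/
theorem KilledBy.mul_comm_apply [FiniteDimensional ℝ V] {K : Submodule ℝ V}
    {g g₀ : V [⋀^ι]→ₗ[ℝ] ℝ} (hg : KilledBy K g) (hg₀ : KilledBy K g₀)
    (hK : Module.finrank ℝ K + Fintype.card ι = Module.finrank ℝ V) (v v₀ : ι → V) :
    g v * g₀ v₀ = g v₀ * g₀ v := by
  have key (v v₀ : ι → V) (h0 : g₀ v₀ ≠ 0) : g v * g₀ v₀ = g v₀ * g₀ v := by
    choose A hA using fun i ↦ hg₀.exists_coeff hK h0 (v i)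
    rw [hg.apply_eq_det_mul (A := A) hA, hg₀.apply_eq_det_mul (A := A) hA]
    ring
  by_cases h0 : g₀ v₀ = 0
  · by_cases h1 : g₀ v = 0
    · rw [h0, h1, mul_zero, mul_zero]
    -- The cross-multiplied identity is symmetric, so either family may serve as the frame.
    · exact (key v₀ v h1).symm
  · exact key v v₀ h0

omit [Fintype ι] [DecidableEq ι] in
theorem killedBy_bot (g : V [⋀^ι]→ₗ[ℝ] ℝ) : KilledBy ⊥ g :=
  fun _ i hv ↦ g.map_coord_zero i ((Submodule.mem_bot ℝ).1 hv)

/-- Cramer's rule in a subspace `K` with basis `e`, the coordinates being read off from linear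
forms `a`. -/
theorem det_smul_eq_sum_cramer [FiniteDimensional ℝ V] {K : Submodule ℝ V}
    (hK : Module.finrank ℝ K = Fintype.card ι) (a : ι → Module.Dual ℝ V) {e : ι → V}
    (he : ∀ i, e i ∈ K) (hdet : (Matrix.of fun i j ↦ a i (e j)).det ≠ 0) {v : V} (hv : v ∈ K) :
    (Matrix.of fun i j ↦ a i (e j)).det • v
      = ∑ j, (Matrix.of fun i j ↦ a i (e j)).cramer (fun i ↦ a i v) j • e j := by
  set N := Matrix.of fun i j ↦ a i (e j) with hN
  have hmul (c : ι → ℝ) : (fun i ↦ a i (∑ j, c j • e j)) = N.mulVec c := by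
    ext i
    simp [hN, Matrix.mulVec, dotProduct, mul_comm]
  have hcr (c : ι → ℝ) : N.cramer (N.mulVec c) = N.det • c := by
    rw [Matrix.cramer_eq_adjugate_mulVec, Matrix.mulVec_mulVec, Matrix.adjugate_mul,
      Matrix.smul_mulVec, Matrix.one_mulVec]
  let e' : ι → K := fun i ↦ ⟨e i, he i⟩
  have hli : LinearIndependent ℝ e' := by
    rw [Fintype.linearIndependent_iff]
    intro c hc
    have h1 : ∑ j, c j • e j = 0 := by simpa [e'] using congrArg Subtype.val hc
    have h2 := hcr c
    rw [← hmul, h1] at h2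
    have h3 : N.det • c = 0 := by
      rw [← h2]
      have : (fun i ↦ a i (0 : V)) = 0 := by ext i; simp
      rw [this, map_zero]
    exact fun i ↦ congrFun ((smul_eq_zero.1 h3).resolve_left hdet) i
  have hspan := hli.span_eq_top_of_card_eq_finrank' hK.symm
  obtain ⟨c, hc⟩ := (Submodule.mem_span_range_iff_exists_fun ℝ).1
    (hspan ▸ Submodule.mem_top : (⟨v, hv⟩ : K) ∈ _)
  have hc' : ∑ j, c j • e j = v := by simpa [e'] using congrArg Subtype.val hc
  rw [← hc', hmul, hcr, Finset.smul_sum]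
  simp [smul_smul]

/-- A form `F` on the source of `s` and a form `ν` killed by the image of `s` combine to a form of
top degree. -/
theorem exists_alternatingMap_sumElim [FiniteDimensional ℝ V] {V' : Type*} [AddCommGroup V']
    [Module ℝ V'] [FiniteDimensional ℝ V'] {κ n : Type*} [Fintype κ] [DecidableEq κ]
    {s : V' →ₗ[ℝ] V} {F : V' [⋀^ι]→ₗ[ℝ] ℝ} {ν : V [⋀^κ]→ₗ[ℝ] ℝ}
    (hF : KilledBy (LinearMap.ker s) F) (hν : KilledBy (LinearMap.range s) ν) (hF0 : F ≠ 0)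
    (hν0 : ν ≠ 0) (hs : Module.finrank ℝ (LinearMap.range s) = Fintype.card ι)
    (hcard : Fintype.card ι + Fintype.card κ = Module.finrank ℝ V) (e : n ≃ ι ⊕ κ) :
    ∃ μ : V [⋀^n]→ₗ[ℝ] ℝ, ∀ (a : ι → V') (w : κ → V),
      μ (Sum.elim (fun i ↦ s (a i)) w ∘ e) = F a * ν w := by
  obtain ⟨a₀, ha₀⟩ := DFunLike.ne_iff.1 hF0
  obtain ⟨w₀, hw₀⟩ := DFunLike.ne_iff.1 hν0
  have hker : Module.finrank ℝ (LinearMap.ker s) + Fintype.card ι = Module.finrank ℝ V' := by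
    rw [← hs, add_comm, LinearMap.finrank_range_add_finrank_ker]
  have hrange : Module.finrank ℝ (LinearMap.range s) + Fintype.card κ = Module.finrank ℝ V := by
    rw [hs, hcard]
  -- A frame adapted to the image of s on which both F and ν are nonzero. The form sought is the
  -- multiple of its determinant with the prescribed value on this one frame.
  let v₀ : ι ⊕ κ → V := Sum.elim (fun i ↦ s (a₀ i)) w₀
  have hli : LinearIndependent ℝ v₀ := by
    rw [Fintype.linearIndependent_iff]
    intro c hc
    simp only [Fintype.sum_sum_type, v₀, Sum.elim_inl, Sum.elim_inr] at hc
    have h1 (j : κ) : c (Sum.inr j) = 0 := by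
      refine hν.coeff_eq_zero hw₀ (c := fun j ↦ c (Sum.inr j)) ⟨-∑ i, c (Sum.inl i) • a₀ i, ?_⟩ j
      rw [map_neg, map_sum, ← sub_eq_zero, ← neg_eq_zero, ← hc]
      simp only [map_smul]
      abel
    have h2 (i : ι) : c (Sum.inl i) = 0 := by
      refine hF.coeff_eq_zero ha₀ (c := fun i ↦ c (Sum.inl i)) ?_ i
      rw [LinearMap.mem_ker, map_sum, ← hc]
      simp [h1]
    rintro (i | j)
    · exact h2 i
    · exact h1 j
  let b := basisOfLinearIndependentOfCardEqFinrank' v₀ hli (by rw [Fintype.card_sum, hcard])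
  have hb : ⇑b = v₀ := coe_basisOfLinearIndependentOfCardEqFinrank' ..
  let μ : V [⋀^ι ⊕ κ]→ₗ[ℝ] ℝ := (F a₀ * ν w₀) • b.det
  have hμ : μ v₀ = F a₀ * ν w₀ := by
    have : b.det v₀ = 1 := by rw [← hb]; exact b.det_self
    simp [μ, this]
  refine ⟨AlternatingMap.domDomCongr e.symm μ, fun a w ↦ ?_⟩
  choose A hA using fun i ↦ hF.exists_coeff hker ha₀ (a i)
  choose B hB using fun i ↦ hν.exists_coeff hrange hw₀ (w i)
  choose a' ha' using hB
  choose C hC using fun i ↦ hF.exists_coeff hker ha₀ (a' i)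
  have hA' (i) : s (a i) = ∑ j, A i j • s (a₀ j) := by
    have := LinearMap.mem_ker.1 (hA i)
    rw [map_sub, map_sum, sub_eq_zero] at this
    simpa using this
  have hC' (i) : s (a' i) = ∑ j, C i j • s (a₀ j) := by
    have := LinearMap.mem_ker.1 (hC i)
    rw [map_sub, map_sum, sub_eq_zero] at this
    simpa using this
  have h1 : AlternatingMap.domDomCongr e.symm μ (Sum.elim (fun i ↦ s (a i)) w ∘ e)
      = μ (Sum.elim (fun i ↦ s (a i)) w) := by
    rw [AlternatingMap.domDomCongr_apply]
    congr 1
    ext i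
    simp
  -- The vectors w are combinations of w₀ only up to the image of s, which accounts for the block C.
  -- The transition matrix is block triangular, so C does not affect its determinant det A * det B.
  have h2 : ∀ i : ι ⊕ κ, Sum.elim (fun i ↦ s (a i)) w i
      - ∑ j, Matrix.fromBlocks (Matrix.of A) 0 (Matrix.of C) (Matrix.of B) i j • v₀ j
        ∈ (⊥ : Submodule ℝ V) := by
    intro i
    rw [Submodule.mem_bot, sub_eq_zero]
    rcases i with i | i
    · simp [v₀, hA']
    · simp only [Fintype.sum_sum_type, v₀, Sum.elim_inl, Sum.elim_inr, Matrix.fromBlocks_apply₂₁,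
        Matrix.fromBlocks_apply₂₂, Matrix.of_apply]
      rw [← hC', ha', sub_add_cancel]
  rw [h1, (killedBy_bot μ).apply_eq_det_mul h2, Matrix.det_fromBlocks_zero₁₂, hμ,
    hF.apply_eq_det_mul (A := Matrix.of A) hA,
    hν.apply_eq_det_mul (v₀ := w₀) (A := Matrix.of B) fun i ↦ ⟨a' i, ha' i⟩]
  ring

end LinearAlgebra

/-! ### Powers of an alternating bilinear form -/

section Pfaffian

variable {V : Type*} [AddCommGroup V] [Module ℝ V]

theorem prod_apply_update {p : ℕ} (W : V →ₗ[ℝ] V →ₗ[ℝ] ℝ) (v : Fin p × Fin 2 → V) (k : Fin p)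
    (i : Fin 2) (z : V) :
    ∏ l, W (Function.update v (k, i) z (l, 0)) (Function.update v (k, i) z (l, 1))
      = W (Function.update v (k, i) z (k, 0)) (Function.update v (k, i) z (k, 1))
        * ∏ l ∈ Finset.univ.erase k, W (v (l, 0)) (v (l, 1)) := by
  rw [← Finset.mul_prod_erase _ _ (Finset.mem_univ k)]
  congr 1
  refine Finset.prod_congr rfl fun l hl ↦ ?_
  simp [Finset.ne_of_mem_erase hl]

/-- The product of the values of a bilinear form on `p` pairs of vectors. -/
def pairProd (p : ℕ) (W : V →ₗ[ℝ] V →ₗ[ℝ] ℝ) :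
    MultilinearMap ℝ (fun _ : Fin p × Fin 2 ↦ V) ℝ where
  toFun v := ∏ k, W (v (k, 0)) (v (k, 1))
  map_update_add' := by
    rintro inst v ⟨k, i⟩ x y
    obtain rfl : inst = instDecidableEqProd := Subsingleton.elim _ _
    simp only [prod_apply_update, ← add_mul]
    congr 1
    fin_cases i <;> simp
  map_update_smul' := by
    rintro inst v ⟨k, i⟩ c x
    obtain rfl : inst = instDecidableEqProd := Subsingleton.elim _ _
    simp only [prod_apply_update, smul_eq_mul, ← mul_assoc]
    congr 1
    fin_cases i <;> simp

/-- The `p`-th exterior power of a bilinear form, up to a positive factor. -/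
def pfaff (p : ℕ) (W : V →ₗ[ℝ] V →ₗ[ℝ] ℝ) : V [⋀^Fin p × Fin 2]→ₗ[ℝ] ℝ :=
  MultilinearMap.alternatization (pairProd p W)

theorem pfaff_apply (p : ℕ) (W : V →ₗ[ℝ] V →ₗ[ℝ] ℝ) (v : Fin p × Fin 2 → V) :
    pfaff p W v = ∑ σ : Equiv.Perm (Fin p × Fin 2),
      ((Equiv.Perm.sign σ : ℤ) : ℝ) * ∏ k, W (v (σ (k, 0))) (v (σ (k, 1))) := by
  rw [pfaff, MultilinearMap.alternatization_apply]
  refine Finset.sum_congr rfl fun σ _ ↦ ?_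
  rw [MultilinearMap.domDomCongr_apply, Units.smul_def, zsmul_eq_mul]
  rfl

theorem killedBy_pfaff (p : ℕ) {W : V →ₗ[ℝ] V →ₗ[ℝ] ℝ} (hW : W.IsAlt) :
    KilledBy (LinearMap.ker W) (pfaff p W) := by
  intro v a ha
  rw [pfaff_apply]
  refine Finset.sum_eq_zero fun σ _ ↦ ?_
  obtain ⟨⟨k, i⟩, rfl⟩ := σ.surjective a
  rw [Finset.prod_eq_zero (Finset.mem_univ k), mul_zero]
  rw [LinearMap.mem_ker] at ha
  fin_cases i
  · exact DFunLike.congr_fun ha _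
  · rw [← hW.neg]
    exact neg_eq_zero.2 (DFunLike.congr_fun ha _)

/-- `v` is a family of `p` hyperbolic pairs. -/
def IsSymplecticFamily {p : ℕ} (W : V →ₗ[ℝ] V →ₗ[ℝ] ℝ) (v : Fin p × Fin 2 → V) : Prop :=
  ∀ k l, W (v (k, 0)) (v (l, 0)) = 0 ∧ W (v (k, 1)) (v (l, 1)) = 0
    ∧ W (v (k, 0)) (v (l, 1)) = (if k = l then 1 else 0)
    ∧ W (v (k, 1)) (v (l, 0)) = (if k = l then -1 else 0)

/-- A term can be nonzero only if σ carries pairs to pairs, possibly flipping some of them. Each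
flip changes the sign of σ and the sign of one factor, so the signs cancel. -/
theorem IsSymplecticFamily.sign_mul_prod_nonneg {p : ℕ} {W : V →ₗ[ℝ] V →ₗ[ℝ] ℝ}
    {v : Fin p × Fin 2 → V} (hv : IsSymplecticFamily W v) (σ : Equiv.Perm (Fin p × Fin 2)) :
    0 ≤ ((Equiv.Perm.sign σ : ℤ) : ℝ) * ∏ k, W (v (σ (k, 0))) (v (σ (k, 1))) := by
  by_cases h0 : ∏ k, W (v (σ (k, 0))) (v (σ (k, 1))) = 0
  · rw [h0, mul_zero]
  replace h0 := Finset.prod_ne_zero_iff.1 h0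
  have hW (x y : Fin p × Fin 2) (h : W (v x) (v y) ≠ 0) : x.1 = y.1 ∧
      ((x.2 = 0 ∧ y.2 = 1 ∧ W (v x) (v y) = 1) ∨ (x.2 = 1 ∧ y.2 = 0 ∧ W (v x) (v y) = -1)) := by
    obtain ⟨k, i⟩ := x
    obtain ⟨l, j⟩ := y
    obtain ⟨h1, h2, h3, h4⟩ := hv k l
    fin_cases i <;> fin_cases j <;> simp_all
  have hσ (k) := hW _ _ (h0 k (Finset.mem_univ k))
  let ε : Fin p → Equiv.Perm (Fin 2) := fun k ↦ if (σ (k, 0)).2 = 0 then 1 else Equiv.swap 0 1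
  let τ : Fin p → Fin p := fun k ↦ (σ (k, 0)).1
  have hform (k : Fin p) (i : Fin 2) : σ (k, i) = (τ k, ε k i) := by
    obtain ⟨h1, h2⟩ := hσ k
    rcases h2 with ⟨h3, h4, -⟩ | ⟨h3, h4, -⟩
    · have : ε k = 1 := if_pos h3
      rw [this]
      fin_cases i
      · exact Prod.ext rfl h3
      · exact Prod.ext h1.symm h4
    · have : ε k = Equiv.swap 0 1 := if_neg (by rw [h3]; decide)
      rw [this]
      fin_cases i
      · exact Prod.ext rfl h3
      · exact Prod.ext h1.symm h4
  have hτ : Function.Injective τ := by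
    intro k l hkl
    have h1 : σ (k, (ε k).symm 0) = σ (l, (ε l).symm 0) := by
      rw [hform, hform, hkl, Equiv.apply_symm_apply, Equiv.apply_symm_apply]
    exact congrArg Prod.fst (σ.injective h1)
  let τ' : Equiv.Perm (Fin p) := Equiv.ofBijective τ (Finite.injective_iff_bijective.1 hτ)
  -- The permutation τ of the pairs acts once on each of the two columns, so its sign enters squared
  -- and only the flips ε contribute.
  have hσ' : σ = Equiv.prodCongrLeft (fun _ : Fin 2 ↦ τ') * Equiv.prodCongrRight ε := by
    ext ⟨k, i⟩ : 1
    rw [hform]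
    rfl
  have hsign : ((Equiv.Perm.sign σ : ℤ) : ℝ) = ∏ k, ((Equiv.Perm.sign (ε k) : ℤ) : ℝ) := by
    rw [hσ', Equiv.Perm.sign_mul, Equiv.Perm.sign_prodCongrLeft, Equiv.Perm.sign_prodCongrRight]
    simp
  rw [hsign, ← Finset.prod_mul_distrib]
  refine Finset.prod_nonneg fun k _ ↦ ?_
  obtain ⟨h1, h2⟩ := hσ k
  rcases h2 with ⟨h3, h4, h5⟩ | ⟨h3, h4, h5⟩
  · have : ε k = 1 := if_pos h3
    rw [this, h5]
    simp
  · have : ε k = Equiv.swap 0 1 := if_neg (by rw [h3]; decide)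
    rw [this, h5, Equiv.Perm.sign_swap (by decide)]
    simp

/-- No cancellation occurs: all terms are nonnegative, and the identity permutation contributes 1.
-/
theorem IsSymplecticFamily.pfaff_ne_zero {p : ℕ} {W : V →ₗ[ℝ] V →ₗ[ℝ] ℝ}
    {v : Fin p × Fin 2 → V} (hv : IsSymplecticFamily W v) : pfaff p W v ≠ 0 := by
  rw [pfaff_apply]
  refine (Finset.sum_pos' (fun σ _ ↦ hv.sign_mul_prod_nonneg σ)
    ⟨1, Finset.mem_univ _, ?_⟩).ne'
  have h1 (k : Fin p) : W (v (k, 0)) (v (k, 1)) = 1 := by simpa using (hv k k).2.2.1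
  simp [h1]

/-- An alternating form of rank at least `2p` has `p` orthogonal hyperbolic pairs. -/
theorem exists_isSymplecticFamily [FiniteDimensional ℝ V] {W : V →ₗ[ℝ] V →ₗ[ℝ] ℝ}
    (hW : W.IsAlt) (p : ℕ) (hp : 2 * p ≤ Module.finrank ℝ (LinearMap.range W)) :
    ∃ v : Fin p × Fin 2 → V, IsSymplecticFamily W v := by
  induction p with
  | zero => exact ⟨fun x ↦ x.1.elim0, fun k ↦ k.elim0⟩
  | succ r ih =>
    obtain ⟨b, hb⟩ := ih (by omega)
    have hneg (x y : V) : W x y = -W y x := (hW.neg y x).symm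
    -- Symplectic Gram–Schmidt: S projects onto the span of the pairs already found, and u - S u is
    -- orthogonal to all of them.
    let S : V → V := fun u ↦ ∑ k, (W u (b (k, 1)) • b (k, 0) - W u (b (k, 0)) • b (k, 1))
    have hS0 (u : V) (l) : W (u - S u) (b (l, 0)) = 0 := by
      simp only [S, map_sub, LinearMap.sub_apply, map_sum, LinearMap.sum_apply, map_smul,
        LinearMap.smul_apply, (hb _ _).1, (hb _ _).2.2.2]
      simp
    have hS1 (u : V) (l) : W (u - S u) (b (l, 1)) = 0 := by
      simp only [S, map_sub, LinearMap.sub_apply, map_sum, LinearMap.sum_apply, map_smul,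
        LinearMap.smul_apply, (hb _ _).2.1, (hb _ _).2.2.1]
      simp
    have hSS (u v : V) : W (u - S u) (S v) = 0 := by
      change W _ (∑ k, _) = 0
      rw [map_sum]
      refine Finset.sum_eq_zero fun k _ ↦ ?_
      rw [map_sub, map_smul, map_smul, hS0, hS1]
      simp
    by_cases hex : ∃ u v, W (u - S u) (v - S v) ≠ 0
    · obtain ⟨u, v, huv⟩ := hex
      set x := u - S u
      have hx0 (l) : W x (b (l, 0)) = 0 := hS0 u l
      have hx1 (l) : W x (b (l, 1)) = 0 := hS1 u l
      set y := (W x (v - S v))⁻¹ • (v - S v) with hy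
      have hxy : W x y = 1 := by rw [hy, map_smul, smul_eq_mul, inv_mul_cancel₀ huv]
      have hy0 (l) : W y (b (l, 0)) = 0 := by
        rw [hy, map_smul, LinearMap.smul_apply, hS0, smul_zero]
      have hy1 (l) : W y (b (l, 1)) = 0 := by
        rw [hy, map_smul, LinearMap.smul_apply, hS1, smul_zero]
      let c : Fin 2 → V := ![x, y]
      refine ⟨fun z ↦ Fin.cons (α := fun _ ↦ V) (c z.2) (fun k : Fin r ↦ b (k, z.2)) z.1, fun k l ↦ ?_⟩
      refine Fin.cases ?_ (fun k ↦ ?_) k <;> refine Fin.cases ?_ (fun l ↦ ?_) l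
      · simp [c, hW x, hW y, hxy, hneg y x]
      · simp [c, hx0, hx1, hy0, hy1, (Fin.succ_ne_zero l).symm]
      · simp [c, hneg (b _), hx0, hx1, hy0, hy1, Fin.succ_ne_zero k]
      · simpa [c] using hb k l
    · push Not at hex
      exfalso
      -- If no further pair exists, W u depends only on S u, so the range of W is spanned by 2r
      -- covectors, against its rank being at least 2r + 2.
      have hker (u : V) : W u = W (S u) := by
        ext v
        have h1 : W (u - S u) v = 0 := by
          rw [← sub_add_cancel v (S v), map_add, hex, hSS, add_zero]
        rw [map_sub, LinearMap.sub_apply] at h1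
        linarith
      have hle : LinearMap.range W ≤ Submodule.span ℝ (Set.range fun a ↦ W (b a)) := by
        rintro _ ⟨u, rfl⟩
        rw [hker]
        simp only [S, map_sum, map_sub, map_smul]
        refine Submodule.sum_mem _ fun k _ ↦ Submodule.sub_mem _ ?_ ?_ <;>
        · exact Submodule.smul_mem _ _ (Submodule.subset_span ⟨_, rfl⟩)
      have h1 := Submodule.finrank_mono hle
      have h2 := finrank_range_le_card (R := ℝ) fun a ↦ W (b a)
      rw [Set.finrank] at h2
      simp only [Fintype.card_prod, Fintype.card_fin] at h2
      omega

end Pfaffian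

/-! ### Tensoriality of operations on fields and forms -/

section Tensoriality

variable {E : Type*} [NormedAddCommGroup E] [NormedSpace ℝ E]
  {M : Type*} [TopologicalSpace M] [ChartedSpace E M] [IsManifold 𝓘(ℝ, E) ∞ M]

omit [IsManifold 𝓘(ℝ, E) ∞ M] in
theorem smoothFun_det {n : ℕ} {N : M → Matrix (Fin n) (Fin n) ℝ}
    (hN : ∀ i j, SmoothFun (E := E) fun y ↦ N y i j) :
    SmoothFun (E := E) fun y ↦ (N y).det := by
  simp only [Matrix.det_apply']
  exact smoothFun_sum fun σ _ ↦ contMDiff_const.mul (smoothFun_prod fun i _ ↦ hN _ _)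

omit [IsManifold 𝓘(ℝ, E) ∞ M] in
theorem smoothFun_cramer {n : ℕ} {N : M → Matrix (Fin n) (Fin n) ℝ} {b : M → Fin n → ℝ}
    (hN : ∀ i j, SmoothFun (E := E) fun y ↦ N y i j)
    (hb : ∀ i, SmoothFun (E := E) fun y ↦ b y i) (k : Fin n) :
    SmoothFun (E := E) fun y ↦ (N y).cramer (b y) k := by
  simp only [Matrix.cramer_apply]
  refine smoothFun_det fun i j ↦ ?_
  by_cases h : j = k
  · simp [h, hb]
  · simp [h, hN]

theorem VF.coe_sum {ι : Type*} (s : Finset ι) (X : ι → VF E M) (x : M) :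
    (∑ i ∈ s, X i) x = ∑ i ∈ s, X i x := by
  have := map_sum (ContMDiffSection.coeAddHom 𝓘(ℝ, E) E ∞ (TangentSpace 𝓘(ℝ, E) : M → Type _)) X s
  exact (congrFun this x).trans (Finset.sum_apply _ _ _)

/-- The `1`-forms as a submodule of the fields of covectors. -/
def oneForms (E : Type*) [NormedAddCommGroup E] [NormedSpace ℝ E] (M : Type*) [TopologicalSpace M]
    [ChartedSpace E M] [IsManifold 𝓘(ℝ, E) ∞ M] : Submodule ℝ (∀ x : M, Cot E M x) where
  carrier := {α | IsSmoothOneForm α}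
  add_mem' hα hβ Y := (hα Y).add (hβ Y)
  zero_mem' _ := contMDiff_const
  smul_mem' _ _ hα Y := contMDiff_const.mul (hα Y)

instance : AddCommGroup (OneForm E M) := inferInstanceAs (AddCommGroup (oneForms E M))

instance : Module ℝ (OneForm E M) := inferInstanceAs (Module ℝ (oneForms E M))

/-- The product `hα` of a smooth function and a `1`-form. -/
def OneForm.fmul (α : OneForm E M) {h : M → ℝ} (hh : SmoothFun (E := E) h) : OneForm E M :=
  ⟨fun x ↦ h x • α.1 x, fun Y ↦ hh.mul (α.2 Y)⟩

theorem OneForm.val_sum {ι : Type*} (s : Finset ι) (α : ι → OneForm E M) (x : M) :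
    (∑ i ∈ s, α i).1 x = ∑ i ∈ s, (α i).1 x := by
  have := congrFun (map_sum (oneForms E M).subtype α s) x
  rw [Finset.sum_apply] at this
  exact this

variable [FiniteDimensional ℝ E]

/-- `D` has constant rank `r`, and its vectors extend to vector fields tangent to `D`. -/
structure IsRegularDist (D : ∀ x : M, Submodule ℝ (Tan E M x)) (r : ℕ) : Prop where
  finrank_eq : ∀ x, Module.finrank ℝ (D x) = r
  exists_field : ∀ (x : M) (v : Tan E M x), v ∈ D x → ∃ X ∈ tangentFields D, X x = v

variable {D : ∀ x : M, Submodule ℝ (Tan E M x)} {r : ℕ}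

theorem isRegularDist_top [T2Space M] :
    IsRegularDist (fun x : M ↦ (⊤ : Submodule ℝ (Tan E M x))) (Module.finrank ℝ E) where
  finrank_eq x := by
    rw [finrank_top]
    rfl
  exists_field x v _ := by
    obtain ⟨X, hX⟩ := exists_VF_apply_eq x v
    exact ⟨X, fun _ ↦ Submodule.mem_top, hX⟩

omit [FiniteDimensional ℝ E] in
theorem mem_tangentFields_top (X : VF E M) :
    X ∈ tangentFields fun x : M ↦ (⊤ : Submodule ℝ (Tan E M x)) := fun _ ↦ Submodule.mem_top

theorem IsRegularDist.exists_linear_extension (hD : IsRegularDist D r) (x : M) :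
    ∃ ext : D x →ₗ[ℝ] VF E M, ∀ v, ext v ∈ tangentFields D ∧ ext v x = v := by
  let ev : tangentFields D →ₗ[ℝ] D x :=
    { toFun := fun X ↦ ⟨X.1 x, X.2 x⟩
      map_add' := fun _ _ ↦ rfl
      map_smul' := fun _ _ ↦ rfl }
  have hev : Function.Surjective ev := fun v ↦ by
    obtain ⟨X, hX, h⟩ := hD.exists_field x v v.2
    exact ⟨⟨X, hX⟩, Subtype.ext h⟩
  obtain ⟨g, hg⟩ := ev.exists_rightInverse_of_surjective (LinearMap.range_eq_top.2 hev)
  refine ⟨(tangentFields D).subtype ∘ₗ g, fun v ↦ ⟨(g v).2, ?_⟩⟩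
  exact congrArg Subtype.val (DFunLike.congr_fun hg v)

variable [T2Space M]

theorem exists_linear_extension (x : M) :
    ∃ ext : Tan E M x →ₗ[ℝ] VF E M, ∀ v, ext v x = v := by
  obtain ⟨ext, h⟩ := (isRegularDist_top (E := E) (M := M)).exists_linear_extension x
  exact ⟨ext ∘ₗ (Submodule.topEquiv.symm).toLinearMap, fun v ↦ (h _).2⟩

/-- The functions are chosen so that their differentials are dual at x to a basis of D x. All data
are global, so Cramer's rule can be used without restricting to a neighbourhood. -/
theorem IsRegularDist.exists_frame (hD : IsRegularDist D r) (x : M) :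
    ∃ (e : Fin r → M → ℝ) (F : Fin r → VF E M), (∀ i, SmoothFun (E := E) (e i)) ∧
      (∀ j, F j ∈ tangentFields D) ∧
      (Matrix.of fun i j ↦ dfun E (e i) x (F j x)).det ≠ 0 := by
  let b := Module.finBasisOfFinrankEq ℝ (D x) (hD.finrank_eq x)
  choose F hF hFx using fun j ↦ hD.exists_field x (b j) (b j).2
  choose a ha using fun i ↦ LinearMap.exists_extend (b.coord i)
  choose e he hex using fun i ↦ exists_smoothFun_dfun_eq x (a i)
  refine ⟨e, F, he, hF, ?_⟩
  have h1 : (Matrix.of fun i j ↦ dfun E (e i) x (F j x)) = 1 := by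
    ext i j
    rw [Matrix.of_apply, hex, hFx]
    refine (DFunLike.congr_fun (ha i) (b j)).trans ?_
    simp [Matrix.one_apply, Finsupp.single_apply, eq_comm]
  simp [h1]

/-- A linear operation on vector fields which is linear over the smooth functions on the fields
tangent to `D` depends only on the value at the point. -/
theorem IsRegularDist.tensorial (hD : IsRegularDist D r) {A : Type*} [AddCommGroup A] [Module ℝ A]
    (T : VF E M →ₗ[ℝ] A) (x : M)
    (hT : ∀ X ∈ tangentFields D, ∀ (h : M → ℝ) (hh : SmoothFun (E := E) h),
      T (X.fmul hh) = h x • T X)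
    {X Y : VF E M} (hX : X ∈ tangentFields D) (hY : Y ∈ tangentFields D) (hXY : X x = Y x) :
    T X = T Y := by
  suffices key : ∀ Z ∈ tangentFields D, Z x = 0 → T Z = 0 by
    have h := key (X - Y) (sub_mem hX hY) (sub_eq_zero.2 hXY)
    rwa [map_sub, sub_eq_zero] at h
  intro Z hZ hZx
  obtain ⟨e, F, he, hF, hdet⟩ := hD.exists_frame x
  let N : M → Matrix (Fin r) (Fin r) ℝ := fun y ↦ Matrix.of fun i j ↦ dfun E (e i) y (F j y)
  let b : M → Fin r → ℝ := fun y i ↦ dfun E (e i) y (Z y)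
  have hN : ∀ i j, SmoothFun (E := E) fun y ↦ N y i j := fun i j ↦ (F j).smooth_deriv (he i)
  have hb : ∀ i, SmoothFun (E := E) fun y ↦ b y i := fun i ↦ Z.smooth_deriv (he i)
  -- One factor det comes from Cramer's rule. The second makes the identity `hsum` hold globally,
  -- both sides being zero where F fails to be a frame. At x the coefficients vanish with Z, while
  -- det² does not.
  have hρ : SmoothFun (E := E) fun y ↦ (N y).det * (N y).det :=
    (smoothFun_det hN).mul (smoothFun_det hN)
  have hc (j) : SmoothFun (E := E) fun y ↦ (N y).det * (N y).cramer (b y) j :=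
    (smoothFun_det hN).mul (smoothFun_cramer hN hb j)
  have hsum : Z.fmul hρ = ∑ j, (F j).fmul (hc j) := by
    ext y
    rw [VF.coe_sum]
    simp only [VF.fmul_apply, mul_smul, ← Finset.smul_sum]
    by_cases h0 : (N y).det = 0
    · rw [h0, zero_smul, zero_smul]
    · rw [← det_smul_eq_sum_cramer (K := D y) (by rw [hD.finrank_eq, Fintype.card_fin])
        (fun i ↦ dfun E (e i) y) (fun j ↦ hF j y) h0 (hZ y)]
  have hb0 : b x = 0 := by
    ext i
    simp [b, hZx]
  have h := hT Z hZ _ hρ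
  rw [hsum, map_sum, Finset.sum_eq_zero] at h
  · exact (smul_eq_zero.1 h.symm).resolve_left (mul_ne_zero hdet hdet)
  · intro j _
    rw [hT _ (hF j), hb0, map_zero, Pi.zero_apply, mul_zero, zero_smul]

/-- A linear operation on `1`-forms which is linear over the smooth functions depends only on the
value at the point. -/
theorem OneForm.tensorial {A : Type*} [AddCommGroup A] [Module ℝ A]
    (T : OneForm E M →ₗ[ℝ] A) (x : M)
    (hT : ∀ (α : OneForm E M) (h : M → ℝ) (hh : SmoothFun (E := E) h),
      T (α.fmul hh) = h x • T α)
    {α β : OneForm E M} (hαβ : α.1 x = β.1 x) : T α = T β := by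
  suffices key : ∀ γ : OneForm E M, γ.1 x = 0 → T γ = 0 by
    have h := key (α - β) (sub_eq_zero.2 hαβ)
    rwa [map_sub, sub_eq_zero] at h
  intro γ hγ
  obtain ⟨e, F, he, -, hdet⟩ := (isRegularDist_top (E := E) (M := M)).exists_frame x
  let N : M → Matrix (Fin (Module.finrank ℝ E)) (Fin (Module.finrank ℝ E)) ℝ :=
    fun y ↦ Matrix.of fun i j ↦ dfun E (e i) y (F j y)
  let b : M → Fin (Module.finrank ℝ E) → ℝ := fun y j ↦ γ.1 y (F j y)
  have hN : ∀ i j, SmoothFun (E := E) fun y ↦ N y i j := fun i j ↦ (F j).smooth_deriv (he i)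
  have hNt : ∀ i j, SmoothFun (E := E) fun y ↦ (N y).transpose i j := fun i j ↦ hN j i
  have hb : ∀ i, SmoothFun (E := E) fun y ↦ b y i := fun i ↦ γ.2 (F i)
  have hρ : SmoothFun (E := E) fun y ↦ (N y).det * (N y).det :=
    (smoothFun_det hN).mul (smoothFun_det hN)
  have hc (j) : SmoothFun (E := E) fun y ↦ (N y).det * (N y).transpose.cramer (b y) j :=
    (smoothFun_det hN).mul (smoothFun_cramer hNt hb j)
  have hsum : γ.fmul hρ = ∑ j, (OneForm.ofFun (e j) (he j)).fmul (hc j) := by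
    refine Subtype.ext (funext fun y ↦ ?_)
    rw [OneForm.val_sum]
    change ((N y).det * (N y).det) • γ.1 y
      = ∑ j, ((N y).det * (N y).transpose.cramer (b y) j) • dfun E (e j) y
    simp only [mul_smul, ← Finset.smul_sum]
    by_cases h0 : (N y).det = 0
    · rw [h0, zero_smul, zero_smul]
    congr 1
    ext v
    have h1 := det_smul_eq_sum_cramer (K := (⊤ : Submodule ℝ (Tan E M y)))
      (by rw [isRegularDist_top.finrank_eq, Fintype.card_fin])
      (fun i ↦ dfun E (e i) y) (e := fun j ↦ F j y) (fun j ↦ Submodule.mem_top) h0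
      (v := v) Submodule.mem_top
    have h2 := congrArg (γ.1 y) h1
    rw [map_smul, map_sum] at h2
    rw [LinearMap.smul_apply]
    refine h2.trans ?_
    rw [LinearMap.sum_apply]
    simp only [map_smul, LinearMap.smul_apply, smul_eq_mul]
    -- Pairing γ with the Cramer expansion of v equals pairing v with the Cramer expansion of γ for
    -- the transposed matrix, since the adjugate commutes with transposition.
    change (N y).cramer (fun i ↦ dfun E (e i) y v) ⬝ᵥ b y
      = (N y).transpose.cramer (b y) ⬝ᵥ (fun i ↦ dfun E (e i) y v)
    rw [Matrix.cramer_eq_adjugate_mulVec, Matrix.cramer_eq_adjugate_mulVec,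
      ← Matrix.adjugate_transpose, Matrix.mulVec_transpose, ← Matrix.dotProduct_mulVec,
      dotProduct_comm]
  have hb0 : b x = 0 := by
    ext i
    simp [b, hγ]
  have h := hT γ _ hρ
  rw [hsum, map_sum, Finset.sum_eq_zero] at h
  · exact (smul_eq_zero.1 h.symm).resolve_left (mul_ne_zero hdet hdet)
  · intro j _
    rw [hT, hb0, map_zero, Pi.zero_apply, mul_zero, zero_smul]

end Tensoriality

/-! ### Lie derivatives of forms -/

section LieDerivative

variable {E : Type*} [NormedAddCommGroup E] [NormedSpace ℝ E] [FiniteDimensional ℝ E]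
  {M : Type*} [TopologicalSpace M] [ChartedSpace E M] [IsManifold 𝓘(ℝ, E) ∞ M] {k : ℕ}
  {η : ∀ x : M, Tan E M x [⋀^Fin k]→ₗ[ℝ] ℝ}

omit [FiniteDimensional ℝ E] in
theorem VF.update_apply (Y : Fin k → VF E M) (i : Fin k) (V : VF E M) (y : M) :
    (fun j ↦ Function.update Y i V j y) = Function.update (fun j ↦ Y j y) i (V y) := by
  ext j
  by_cases h : j = i
  · subst h; simp
  · simp [h]

omit [FiniteDimensional ℝ E] in
theorem IsSmoothForm.smooth_update (hη : IsSmoothForm η) (Y : Fin k → VF E M) (i : Fin k)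
    (V : VF E M) : SmoothFun (E := E) fun y ↦ η y (Function.update (fun j ↦ Y j y) i (V y)) := by
  simp only [← VF.update_apply]
  exact hη _

theorem IsSmoothForm.smooth_lieDerivForm (hη : IsSmoothForm η) (X : VF E M) (Y : Fin k → VF E M) :
    SmoothFun (E := E) (lieDerivForm X η Y) :=
  (X.smooth_deriv (hη Y)).sub (smoothFun_sum fun i _ ↦ hη.smooth_update Y i (X.bracket (Y i)))

theorem lieDerivForm_update (X : VF E M) (Y : Fin k → VF E M) (i : Fin k) (V : VF E M) (x : M) :
    lieDerivForm X η (Function.update Y i V) x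
      = X.deriv (fun y ↦ η y (Function.update (fun j ↦ Y j y) i (V y))) x
        - η x (Function.update (fun j ↦ Y j x) i (X.bracket V x))
        - ∑ j ∈ Finset.univ.erase i,
          η x (Function.update (Function.update (fun l ↦ Y l x) j (X.bracket (Y j) x)) i (V x)) := by
  rw [lieDerivForm, ← Finset.add_sum_erase _ _ (Finset.mem_univ i), sub_sub]
  simp only [VF.update_apply, Function.update_self, Function.update_idem]
  congr 2
  refine Finset.sum_congr rfl fun j hj ↦ ?_
  have hj : j ≠ i := Finset.ne_of_mem_erase hj
  rw [Function.update_of_ne hj, Function.update_comm hj]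

/-- The Lie derivative as a linear operation on one of the arguments. -/
def lieDerivArg (hη : IsSmoothForm η) (X : VF E M) (Y : Fin k → VF E M) (i : Fin k) (x : M) :
    VF E M →ₗ[ℝ] ℝ where
  toFun V := lieDerivForm X η (Function.update Y i V) x
  map_add' V W := by
    have h := X.deriv_add (hη.smooth_update Y i V) (hη.smooth_update Y i W) x
    simp only [← AlternatingMap.map_update_add] at h
    simp only [lieDerivForm_update, VF.bracket_add, ContMDiffSection.coe_add, Pi.add_apply,
      AlternatingMap.map_update_add, Finset.sum_add_distrib] at h ⊢
    rw [h]
    ring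
  map_smul' c V := by
    have h := X.deriv_const_mul c (hη.smooth_update Y i V) x
    simp only [lieDerivForm_update, VF.bracket_smul, ContMDiffSection.coe_smul, Pi.smul_apply,
      AlternatingMap.map_update_smul, smul_eq_mul, ← Finset.mul_sum, RingHom.id_apply] at h ⊢
    rw [h]
    ring

/-- The term with X.h produced by the product rule cancels the one produced by [X, hV]. -/
theorem lieDerivArg_fmul (hη : IsSmoothForm η) (X : VF E M) (Y : Fin k → VF E M) (i : Fin k)
    (x : M) (V : VF E M) {h : M → ℝ} (hh : SmoothFun (E := E) h) :
    lieDerivArg hη X Y i x (V.fmul hh) = h x * lieDerivArg hη X Y i x V := by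
  change lieDerivForm X η (Function.update Y i (V.fmul hh)) x
    = h x * lieDerivForm X η (Function.update Y i V) x
  have h1 := X.deriv_mul hh (hη.smooth_update Y i V) x
  simp only [lieDerivForm_update, VF.bracket_fmul, VF.fmul_apply, AlternatingMap.map_update_add,
    AlternatingMap.map_update_smul, smul_eq_mul, ← Finset.mul_sum] at h1 ⊢
  rw [h1]
  ring

theorem lieDerivForm_congr [T2Space M] (hη : IsSmoothForm η) (X : VF E M) {Y Z : Fin k → VF E M}
    {x : M} (h : ∀ i, Y i x = Z i x) : lieDerivForm X η Y x = lieDerivForm X η Z x := by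
  have hupd (W : Fin k → VF E M) (i : Fin k) (U V : VF E M) (hUV : U x = V x) :
      lieDerivForm X η (Function.update W i U) x = lieDerivForm X η (Function.update W i V) x :=
    isRegularDist_top.tensorial (lieDerivArg hη X W i x) x
      (fun V _ h hh ↦ lieDerivArg_fmul hη X W i x V hh)
      (mem_tangentFields_top U) (mem_tangentFields_top V) hUV
  have key (s : Finset (Fin k)) :
      lieDerivForm X η (s.piecewise Y Z) x = lieDerivForm X η Z x := by
    induction s using Finset.induction_on with
    | empty => simp
    | insert a s ha ih =>
      rw [Finset.piecewise_insert, ← ih, hupd _ a (Y a) (Z a) (h a)]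
      congr 1
      rw [Function.update_eq_self_iff, Finset.piecewise_eq_of_notMem _ _ _ ha]
  simpa using key Finset.univ

/-- The terms with the bracket in slot i and in slot j differ by a transposition and cancel; every
other term keeps two equal arguments. -/
theorem lieDerivForm_eq_zero_of_eq (X : VF E M) (Y : Fin k → VF E M) {i j : Fin k} (hij : i ≠ j)
    (h : Y i = Y j) (x : M) : lieDerivForm X η Y x = 0 := by
  have h1 : (fun y ↦ η y fun l ↦ Y l y) = fun _ ↦ 0 := by
    ext y
    exact (η y).map_eq_zero_of_eq _ (by rw [h]) hij
  rw [lieDerivForm, h1, VF.deriv_zero, zero_sub, neg_eq_zero,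
    ← Finset.add_sum_erase _ _ (Finset.mem_univ i),
    ← Finset.add_sum_erase _ _ (Finset.mem_erase.2 ⟨hij.symm, Finset.mem_univ j⟩),
    Finset.sum_eq_zero, add_zero]
  · have h2 : Function.update (fun l ↦ Y l x) j (X.bracket (Y j) x)
        = Function.update (fun l ↦ Y l x) i (X.bracket (Y i) x) ∘ Equiv.swap i j := by
      ext l
      by_cases hi : l = i
      · subst hi
        simp [hij.symm, hij, h]
      by_cases hj : l = j
      · subst hj
        simp [h]
      · simp [hi, hj, Equiv.swap_apply_of_ne_of_ne]
    rw [h2, (η x).map_swap _ hij, add_neg_cancel]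
  · intro l hl
    rw [Finset.mem_erase, Finset.mem_erase] at hl
    refine (η x).map_eq_zero_of_eq _ ?_ hij
    rw [Function.update_of_ne hl.2.1.symm, Function.update_of_ne hl.1.symm, h]

/-- The Lie derivative of a form is a form. -/
theorem exists_lieDerivForm_eq [T2Space M] (hη : IsSmoothForm η) (X : VF E M) (x : M) :
    ∃ g : Tan E M x [⋀^Fin k]→ₗ[ℝ] ℝ,
      ∀ Y : Fin k → VF E M, lieDerivForm X η Y x = g fun i ↦ Y i x := by
  obtain ⟨ext, hext⟩ := exists_linear_extension (E := E) x
  have hupd (v : Fin k → Tan E M x) (i : Fin k) (w : Tan E M x) :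
      (fun j ↦ ext (Function.update v i w j)) = Function.update (fun j ↦ ext (v j)) i (ext w) := by
    ext j : 1
    by_cases h : j = i
    · subst h; simp
    · simp [h]
  let g : Tan E M x [⋀^Fin k]→ₗ[ℝ] ℝ :=
    { toFun := fun v ↦ lieDerivForm X η (fun i ↦ ext (v i)) x
      map_update_add' := by
        intro inst v i a b
        obtain rfl : inst = instDecidableEqFin k := Subsingleton.elim _ _
        simp only [hupd, map_add]
        exact map_add (lieDerivArg hη X (fun j ↦ ext (v j)) i x) _ _
      map_update_smul' := by
        intro inst v i c a
        obtain rfl : inst = instDecidableEqFin k := Subsingleton.elim _ _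
        simp only [hupd, map_smul]
        exact map_smul (lieDerivArg hη X (fun j ↦ ext (v j)) i x) _ _
      map_eq_zero_of_eq' := by
        intro v i j hv hij
        exact lieDerivForm_eq_zero_of_eq X _ hij (congrArg ext hv) x }
  exact ⟨g, fun Y ↦ lieDerivForm_congr hη X fun i ↦ (hext _).symm⟩

theorem add_lieDerivForm (X X' : VF E M) (Y : Fin k → VF E M) (x : M) :
    lieDerivForm (X + X') η Y x = lieDerivForm X η Y x + lieDerivForm X' η Y x := by
  simp only [lieDerivForm, VF.add_deriv, VF.add_bracket, AlternatingMap.map_update_add,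
    Finset.sum_add_distrib]
  ring

theorem smul_lieDerivForm (c : ℝ) (X : VF E M) (Y : Fin k → VF E M) (x : M) :
    lieDerivForm (c • X) η Y x = c * lieDerivForm X η Y x := by
  simp only [lieDerivForm, VF.smul_deriv, VF.smul_bracket, AlternatingMap.map_update_smul,
    smul_eq_mul, ← Finset.mul_sum]
  ring

/-- The bracket [hX, Y i] has the extra part -(Y i . h) X, which η does not see when contraction
with X kills it. Function-linearity in X fails for a general form. -/
theorem fmul_lieDerivForm {X : VF E M} {x : M}
    (hX : ∀ (v : Fin k → Tan E M x) (i : Fin k), v i = X x → η x v = 0)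
    {h : M → ℝ} (hh : SmoothFun (E := E) h) (Y : Fin k → VF E M) :
    lieDerivForm (X.fmul hh) η Y x = h x * lieDerivForm X η Y x := by
  have h0 (i : Fin k) : η x (Function.update (fun j ↦ Y j x) i (X x)) = 0 := hX _ i (by simp)
  simp only [lieDerivForm, VF.deriv_fmul, VF.fmul_bracket, AlternatingMap.map_update_add,
    AlternatingMap.map_update_neg, AlternatingMap.map_update_smul, h0,
    smul_eq_mul, mul_zero, neg_zero, zero_add, ← Finset.mul_sum]
  ring

theorem lieDerivForm_mul (hη : IsSmoothForm η) (X : VF E M) {g : M → ℝ}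
    (hg : SmoothFun (E := E) g) (Y : Fin k → VF E M) (x : M) :
    lieDerivForm X (fun y ↦ g y • η y) Y x
      = X.deriv g x * (η x fun i ↦ Y i x) + g x * lieDerivForm X η Y x := by
  have h := X.deriv_mul hg (hη Y) x
  simp only [lieDerivForm, AlternatingMap.smul_apply, smul_eq_mul, ← Finset.mul_sum]
  rw [h]
  ring

end LieDerivative

/-! ### The symplectic foliation and the map in cohomology -/

section Poisson

variable {E : Type*} [NormedAddCommGroup E] [NormedSpace ℝ E] [FiniteDimensional ℝ E]
  {M : Type*} [TopologicalSpace M] [ChartedSpace E M] [IsManifold 𝓘(ℝ, E) ∞ M]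

omit [IsManifold 𝓘(ℝ, E) ∞ M] in
theorem tan_ext {x : M} {v w : Tan E M x} (h : ∀ a : Cot E M x, a v = a w) : v = w := by
  rw [← sub_eq_zero, ← Module.forall_dual_apply_eq_zero_iff ℝ]
  intro a
  rw [map_sub, h, sub_self]

namespace PoissonTensor

variable (π : PoissonTensor E M)

omit [FiniteDimensional ℝ E] in
theorem skew {x : M} (a b : Cot E M x) : π.toFun x a b = -π.toFun x b a :=
  (LinearMap.IsAlt.neg (B := π.toFun x) (π.alt x) b a).symm

omit [FiniteDimensional ℝ E] in
theorem smooth_apply_dfun {f g : M → ℝ} (hf : SmoothFun (E := E) f) (hg : SmoothFun (E := E) g) :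
    SmoothFun (E := E) fun y ↦ π.toFun y (dfun E f y) (dfun E g y) :=
  π.smooth (OneForm.ofFun f hf) (OneForm.ofFun g hg)

variable [T2Space M]

theorem apply_sharpField (α : OneForm E M) (x : M) (a : Cot E M x) :
    a (π.sharpField α x) = π.toFun x (α.1 x) a :=
  π.apply_sharp _ _

theorem sharpField_deriv (α : OneForm E M) (f : M → ℝ) (x : M) :
    (π.sharpField α).deriv f x = π.toFun x (α.1 x) (dfun E f x) :=
  π.apply_sharp _ _

theorem sharpField_mem (α : OneForm E M) : π.sharpField α ∈ tangentFields π.dist :=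
  (π.sharpTangent α).2

theorem sharpField_add (α β : OneForm E M) :
    π.sharpField (α + β) = π.sharpField α + π.sharpField β := by
  ext x
  exact map_add (π.sharp x) (α.1 x) (β.1 x)

theorem sharpField_smul (c : ℝ) (α : OneForm E M) :
    π.sharpField (c • α) = c • π.sharpField α := by
  ext x
  exact map_smul (π.sharp x) c (α.1 x)

theorem sharpField_fmul (α : OneForm E M) {h : M → ℝ} (hh : SmoothFun (E := E) h) :
    π.sharpField (α.fmul hh) = (π.sharpField α).fmul hh := by
  ext x
  exact map_smul (π.sharp x) (h x) (α.1 x)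

/-- The Hamiltonian vector field `π(df)`. -/
def ham {f : M → ℝ} (hf : SmoothFun (E := E) f) : VF E M := π.sharpField (OneForm.ofFun f hf)

theorem ham_deriv {f : M → ℝ} (hf : SmoothFun (E := E) f) (g : M → ℝ) (x : M) :
    (π.ham hf).deriv g x = π.toFun x (dfun E f x) (dfun E g x) :=
  π.sharpField_deriv _ _ _

theorem ham_mem {f : M → ℝ} (hf : SmoothFun (E := E) f) : π.ham hf ∈ tangentFields π.dist :=
  π.sharpField_mem _

/-- `[π(df), π(dg)] = π(d{f, g})`. -/
theorem bracket_ham {f g : M → ℝ} (hf : SmoothFun (E := E) f) (hg : SmoothFun (E := E) g) :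
    (π.ham hf).bracket (π.ham hg) = π.ham (π.smooth_apply_dfun hf hg) := by
  ext x
  refine tan_ext fun a ↦ ?_
  obtain ⟨h, hh, rfl⟩ := exists_smoothFun_dfun_eq x a
  change ((π.ham hf).bracket (π.ham hg)).deriv h x = (π.ham _).deriv h x
  rw [VF.bracket_deriv _ _ hh, ham_deriv, ham_deriv, ham_deriv]
  have e (f : M → ℝ) (hf : SmoothFun (E := E) f) :
      (π.ham hf).deriv h = fun y ↦ π.toFun y (dfun E f y) (dfun E h y) :=
    funext fun y ↦ π.ham_deriv hf h y
  have e' : (fun y ↦ π.toFun y (dfun E h y) (dfun E f y))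
      = fun y ↦ -1 * π.toFun y (dfun E f y) (dfun E h y) := by
    ext y
    rw [π.skew]
    ring
  have hj := π.jacobi f g h hf hg hh x
  rw [e', dfun_const_mul _ (π.smooth_apply_dfun hf hh), map_smul, smul_eq_mul] at hj
  rw [e f hf, e g hg, π.skew _ (dfun E h x)]
  linarith

variable {r : ℕ}

theorem isRegularDist (hr : ∀ x : M, Module.finrank ℝ (π.dist x) = r) :
    IsRegularDist π.dist r where
  finrank_eq := hr
  exists_field x v hv := by
    obtain ⟨a, rfl⟩ := hv
    obtain ⟨f, hf, rfl⟩ := exists_smoothFun_dfun_eq x a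
    exact ⟨π.ham hf, π.ham_mem hf, rfl⟩

theorem exists_ham_eq {x : M} {v : Tan E M x} (hv : v ∈ π.dist x) :
    ∃ (f : M → ℝ) (hf : SmoothFun (E := E) f), π.ham hf x = v := by
  obtain ⟨a, rfl⟩ := hv
  obtain ⟨f, hf, rfl⟩ := exists_smoothFun_dfun_eq x a
  exact ⟨f, hf, rfl⟩

/-- The characteristic distribution of a regular Poisson tensor is involutive. -/
theorem bracket_mem (hr : ∀ x : M, Module.finrank ℝ (π.dist x) = r) {X Y : VF E M}
    (hX : X ∈ tangentFields π.dist) (hY : Y ∈ tangentFields π.dist) :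
    X.bracket Y ∈ tangentFields π.dist := by
  intro x
  have hD := π.isRegularDist hr
  have hq {v : Tan E M x} : (π.dist x).mkQ v = 0 ↔ v ∈ π.dist x := Submodule.Quotient.mk_eq_zero _
  let T (Y : VF E M) : VF E M →ₗ[ℝ] (Tan E M x ⧸ π.dist x) :=
    { toFun := fun X ↦ (π.dist x).mkQ (X.bracket Y x)
      map_add' := fun X X' ↦ by rw [VF.add_bracket, map_add]
      map_smul' := fun c X ↦ by rw [VF.smul_bracket, map_smul]; rfl }
  -- Modulo D, the value of [X, Y] at x is function-linear in X tangent to D, because the extra term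
  -- in [hX, Y] is a multiple of X. So X, and after a swap Y, can be replaced by a Hamiltonian field
  -- with the same value at x.
  have hT (Y : VF E M) {X X' : VF E M} (hX : X ∈ tangentFields π.dist)
      (hX' : X' ∈ tangentFields π.dist) (h : X x = X' x) (hb : X'.bracket Y x ∈ π.dist x) :
      X.bracket Y x ∈ π.dist x := by
    have h1 := hD.tensorial (T Y) x (fun X hX h hh ↦ by
      change (π.dist x).mkQ ((X.fmul hh).bracket Y x) = h x • (π.dist x).mkQ (X.bracket Y x)
      rw [VF.fmul_bracket, map_add, map_smul, map_neg, map_smul,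
        hq.2 (hX x), smul_zero, neg_zero, zero_add]) hX hX' h
    change (π.dist x).mkQ (X.bracket Y x) = (π.dist x).mkQ (X'.bracket Y x) at h1
    exact hq.1 (h1.trans (hq.2 hb))
  obtain ⟨f, hf, hfx⟩ := π.exists_ham_eq (hX x)
  obtain ⟨g, hg, hgx⟩ := π.exists_ham_eq (hY x)
  refine hT Y hX (π.ham_mem hf) hfx.symm ?_
  rw [VF.bracket_swap]
  refine (π.dist x).neg_mem (hT _ hY (π.ham_mem hg) hgx.symm ?_)
  rw [bracket_ham]
  exact π.ham_mem _ x

/-- The derivatives of Q(α) and Q(β) cancel against those inside the Koszul bracket. The remaining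
expression shows antisymmetry and tensoriality. -/
theorem dPoisson_eq (Q : VF E M) (α β : OneForm E M) (x : M) :
    π.dPoisson Q α β x = β.1 x ((π.sharpField α).bracket Q x) - α.1 x ((π.sharpField β).bracket Q x)
      + Q.deriv (fun y ↦ π.toFun y (α.1 y) (β.1 y)) x := by
  simp only [dPoisson, koszul, lieDerivOneForm, OneForm.eval]
  ring

theorem dPoisson_swap (Q : VF E M) (α β : OneForm E M) (x : M) :
    π.dPoisson Q α β x = -π.dPoisson Q β α x := by
  have h : (fun y ↦ π.toFun y (α.1 y) (β.1 y)) = fun y ↦ -1 * π.toFun y (β.1 y) (α.1 y) := by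
    ext y
    rw [π.skew]
    ring
  rw [dPoisson_eq, dPoisson_eq, h, VF.deriv_const_mul _ _ (π.smooth β α)]
  ring

/-- `d_π Q(α, β)` as a linear operation on `α`. -/
def dPoissonLeft (Q : VF E M) (β : OneForm E M) (x : M) : OneForm E M →ₗ[ℝ] ℝ where
  toFun α := π.dPoisson Q α β x
  map_add' α α' := by
    have h : (fun y ↦ π.toFun y ((α + α').1 y) (β.1 y))
        = fun y ↦ π.toFun y (α.1 y) (β.1 y) + π.toFun y (α'.1 y) (β.1 y) := by
      ext y
      exact LinearMap.map_add₂ (π.toFun y) (α.1 y) (α'.1 y) (β.1 y)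
    have h' (v : Tan E M x) : (α + α').1 x v = α.1 x v + α'.1 x v := rfl
    simp only [dPoisson_eq, sharpField_add, VF.add_bracket, map_add, h,
      Q.deriv_add (π.smooth α β) (π.smooth α' β), h']
    ring
  map_smul' c α := by
    have h : (fun y ↦ π.toFun y ((c • α).1 y) (β.1 y))
        = fun y ↦ c * π.toFun y (α.1 y) (β.1 y) := by
      ext y
      exact LinearMap.map_smul₂ (π.toFun y) c (α.1 y) (β.1 y)
    have h' (v : Tan E M x) : (c • α).1 x v = c * α.1 x v := rfl
    simp only [dPoisson_eq, sharpField_smul, VF.smul_bracket, map_smul, h,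
      Q.deriv_const_mul c (π.smooth α β), h', smul_eq_mul, RingHom.id_apply]
    ring

/-- The term (Q.h) π(α, β) from the last derivative cancels the one from [hπ(α), Q]. -/
theorem dPoisson_fmul (Q : VF E M) (α β : OneForm E M) {h : M → ℝ} (hh : SmoothFun (E := E) h)
    (x : M) : π.dPoisson Q (α.fmul hh) β x = h x * π.dPoisson Q α β x := by
  have h1 : (fun y ↦ π.toFun y ((α.fmul hh).1 y) (β.1 y))
      = fun y ↦ h y * π.toFun y (α.1 y) (β.1 y) := by
    ext y
    exact LinearMap.map_smul₂ (π.toFun y) (h y) (α.1 y) (β.1 y)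
  have h' (v : Tan E M x) : (α.fmul hh).1 x v = h x * α.1 x v := rfl
  simp only [dPoisson_eq, sharpField_fmul, VF.fmul_bracket, map_add, map_neg, map_smul, h1,
    Q.deriv_mul hh (π.smooth α β), h', smul_eq_mul, apply_sharpField]
  ring

/-- `d_π Q(α, β)` depends only on the values of `α` and `β` at the point. -/
theorem dPoisson_congr (Q : VF E M) {α α' β β' : OneForm E M} {x : M} (hα : α.1 x = α'.1 x)
    (hβ : β.1 x = β'.1 x) : π.dPoisson Q α β x = π.dPoisson Q α' β' x := by
  have h (β : OneForm E M) {α α' : OneForm E M} (hα : α.1 x = α'.1 x) :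
      π.dPoisson Q α β x = π.dPoisson Q α' β x :=
    OneForm.tensorial (π.dPoissonLeft Q β x) x (fun α _ hh ↦ π.dPoisson_fmul Q α β hh x) hα
  rw [h β hα, dPoisson_swap, h α' hβ, ← dPoisson_swap]

theorem push_deriv (α : TangForm π.dist) (f : M → ℝ) (hf : SmoothFun (E := E) f) (x : M) :
    (π.push α).deriv f x = leafEval α.1 (π.sharpTangent (OneForm.ofFun f hf)) x :=
  π.apply_push α x _

/-- `d_π π(α) = 0` if `d_𝓕 α = 0`. -/
theorem push_mem_cocycles {α : TangForm π.dist} (hα : α ∈ leafCocycles π.dist) :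
    π.push α ∈ π.cocycles := by
  intro β γ x
  obtain ⟨f, hf, hfx⟩ := exists_smoothFun_dfun_eq x (β.1 x)
  obtain ⟨g, hg, hgx⟩ := exists_smoothFun_dfun_eq x (γ.1 x)
  -- By tensoriality only exact forms need testing. There Q.f = α(π(df)), and the Hamiltonian
  -- bracket turns the expression into d_𝓕 α(π(df), π(dg)).
  rw [π.dPoisson_congr _ (α' := OneForm.ofFun f hf) (β' := OneForm.ofFun g hg) hfx.symm hgx.symm,
    dPoisson_eq]
  set Q := π.push α with hQ
  have hb := π.bracket_ham hf hg
  have hmem : (π.ham hf).bracket (π.ham hg) x ∈ π.dist x := by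
    rw [hb]
    exact π.ham_mem _ x
  have h1 := hα (π.sharpTangent (OneForm.ofFun f hf)) (π.sharpTangent (OneForm.ofFun g hg)) x hmem
  have ef : Q.deriv f = leafEval α.1 (π.sharpTangent (OneForm.ofFun f hf)) :=
    funext (π.push_deriv α f hf)
  have eg : Q.deriv g = leafEval α.1 (π.sharpTangent (OneForm.ofFun g hg)) :=
    funext (π.push_deriv α g hg)
  have efg : α.1 x ⟨(π.ham hf).bracket (π.ham hg) x, hmem⟩
      = Q.deriv (fun y ↦ π.toFun y (dfun E f y) (dfun E g y)) x := by
    rw [π.push_deriv α _ (π.smooth_apply_dfun hf hg)]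
    simp only [hb]
    rfl
  change (π.ham hf).deriv _ x - (π.ham hg).deriv _ x
    - α.1 x ⟨(π.ham hf).bracket (π.ham hg) x, hmem⟩ = 0 at h1
  rw [← ef, ← eg, efg] at h1
  change ((π.ham hf).bracket Q).deriv g x - ((π.ham hg).bracket Q).deriv f x
    + Q.deriv (fun y ↦ π.toFun y (dfun E f y) (dfun E g y)) x = 0
  rw [VF.bracket_deriv _ _ hg, VF.bracket_deriv _ _ hf]
  have e1 : (π.ham hf).deriv g = fun y ↦ π.toFun y (dfun E f y) (dfun E g y) :=
    funext fun y ↦ π.ham_deriv hf g y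
  have e2 : (π.ham hg).deriv f = fun y ↦ -1 * π.toFun y (dfun E f y) (dfun E g y) := by
    ext y
    rw [π.ham_deriv hg f y, π.skew]
    ring
  rw [e1, e2, VF.deriv_const_mul _ _ (π.smooth_apply_dfun hf hg)]
  linarith

/-- Testing on covectors a and testing on the tangent vectors π(a) is the same, since these exhaust
the foliation. One direction makes the map on classes well defined, the other makes it injective. -/
theorem push_mem_coboundaries_iff {α : TangForm π.dist} :
    π.push α ∈ π.coboundaries ↔ α ∈ leafCoboundaries π.dist := by
  constructor
  · rintro ⟨f, hf, h⟩
    refine ⟨f, hf, fun X x ↦ ?_⟩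
    obtain ⟨a, ha⟩ := X.2 x
    obtain ⟨g, hg, rfl⟩ := exists_smoothFun_dfun_eq x a
    have h1 := h (OneForm.ofFun g hg) x
    have h2 : α.1 x ⟨π.sharp x (dfun E g x), LinearMap.mem_range_self _ _⟩
        = dfun E f x (π.sharp x (dfun E g x)) := (π.apply_push α x _).symm.trans h1
    have h3 : (⟨X.1 x, X.2 x⟩ : π.dist x)
        = ⟨π.sharp x (dfun E g x), LinearMap.mem_range_self _ _⟩ := Subtype.ext ha.symm
    rw [leafEval, h3, h2, ha]
    rfl
  · rintro ⟨f, hf, h⟩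
    exact ⟨f, hf, fun β x ↦ (π.apply_push α x _).trans (h (π.sharpTangent β) x)⟩

/-- The map induced by `push` in cohomology. -/
def pushH1 : LeafH1 π.dist →ₗ[ℝ] π.H1 :=
  Submodule.mapQ _ _ ((π.push ∘ₗ (leafCocycles π.dist).subtype).codRestrict π.cocycles
    fun α ↦ π.push_mem_cocycles α.2) fun _ hα ↦ π.push_mem_coboundaries_iff.2 hα

theorem pushH1_leafClass (α : leafCocycles π.dist) :
    π.pushH1 (leafClass α) = π.cohomClass ⟨π.push α.1, π.push_mem_cocycles α.2⟩ := rfl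

theorem pushH1_injective : Function.Injective π.pushH1 := by
  rw [← LinearMap.ker_eq_bot, LinearMap.ker_eq_bot']
  intro c
  induction c using Submodule.Quotient.induction_on with
  | _ α =>
    intro h
    rw [Submodule.Quotient.mk_eq_zero]
    have h1 := (Submodule.Quotient.mk_eq_zero (π.coboundaries.submoduleOf π.cocycles)).1 h
    exact π.push_mem_coboundaries_iff.1 h1

end PoissonTensor

end Poisson

/-! ### The Reeb form and the Reeb class -/

section ReebForm

variable {E : Type*} [NormedAddCommGroup E] [NormedSpace ℝ E] [FiniteDimensional ℝ E]
  {M : Type*} [TopologicalSpace M] [ChartedSpace E M] [IsManifold 𝓘(ℝ, E) ∞ M]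
  {D : ∀ x : M, Submodule ℝ (Tan E M x)} {r q : ℕ}

/-- The tangential form `d_𝓕 f`. -/
def leafDiff (D : ∀ x : M, Submodule ℝ (Tan E M x)) {f : M → ℝ} (hf : SmoothFun (E := E) f) :
    TangForm D :=
  ⟨fun x ↦ dfun E f x ∘ₗ (D x).subtype, fun X ↦ X.1.smooth_deriv hf⟩

omit [FiniteDimensional ℝ E] in
theorem leafEval_leafDiff {f : M → ℝ} (hf : SmoothFun (E := E) f) (X : tangentFields D) (x : M) :
    leafEval (leafDiff D hf).1 X x = X.1.deriv f x := rfl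

omit [FiniteDimensional ℝ E] in
theorem leafEval_add (α β : TangForm D) (X : tangentFields D) (x : M) :
    leafEval (α + β).1 X x = leafEval α.1 X x + leafEval β.1 X x := rfl

omit [FiniteDimensional ℝ E] in
theorem leafDiff_mem_coboundaries {f : M → ℝ} (hf : SmoothFun (E := E) f) :
    leafDiff D hf ∈ leafCoboundaries D := ⟨f, hf, fun _ _ ↦ rfl⟩

variable [T2Space M]

theorem leafDiff_mem_cocycles {f : M → ℝ} (hf : SmoothFun (E := E) f) :
    leafDiff D hf ∈ leafCocycles D := by
  intro X Y x h
  have := X.1.bracket_deriv Y.1 hf x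
  change X.1.deriv (Y.1.deriv f) x - Y.1.deriv (X.1.deriv f) x - (X.1.bracket Y.1).deriv f x = 0
  rw [this, sub_self]

omit [FiniteDimensional ℝ E] [IsManifold 𝓘(ℝ, E) ∞ M] [T2Space M] in
theorem exists_apply_ne_zero {k : ℕ} {η : ∀ x : M, Tan E M x [⋀^Fin k]→ₗ[ℝ] ℝ}
    (h0 : NowhereZero η) (x : M) : ∃ v, η x v ≠ 0 :=
  DFunLike.ne_iff.1 (h0 x)

theorem exists_fields_apply_ne_zero {k : ℕ} {η : ∀ x : M, Tan E M x [⋀^Fin k]→ₗ[ℝ] ℝ}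
    (h0 : NowhereZero η) (x : M) : ∃ Z : Fin k → VF E M, η x (fun i ↦ Z i x) ≠ 0 := by
  obtain ⟨v, hv⟩ := exists_apply_ne_zero h0 x
  choose Z hZ using fun i ↦ exists_VF_apply_eq x (v i)
  exact ⟨Z, by simpa only [hZ] using hv⟩

/-- Nowhere vanishing forms of degree `codim D` killed by `D` differ by a nowhere vanishing smooth
function. -/
theorem exists_eq_fmul {k : ℕ} {η η' : ∀ x : M, Tan E M x [⋀^Fin k]→ₗ[ℝ] ℝ}
    (hD : ∀ x, Module.finrank ℝ (D x) + k = Module.finrank ℝ E)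
    (hη : IsSmoothForm η) (hη' : IsSmoothForm η') (h0 : NowhereZero η) (h0' : NowhereZero η')
    (hk : ∀ x, KilledBy (D x) (η x)) (hk' : ∀ x, KilledBy (D x) (η' x)) :
    ∃ g : M → ℝ, SmoothFun (E := E) g ∧ (∀ x, g x ≠ 0) ∧ ∀ x, η' x = g x • η x := by
  choose v hv using fun x ↦ exists_apply_ne_zero h0 x
  have hprop (x : M) (u w : Fin k → Tan E M x) : η' x u * η x w = η' x w * η x u :=
    (hk' x).mul_comm_apply (hk x) (by rw [Fintype.card_fin]; exact hD x) u w
  let g : M → ℝ := fun x ↦ η' x (v x) / η x (v x)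
  have hg (x : M) : η' x = g x • η x := by
    ext u
    rw [AlternatingMap.smul_apply, smul_eq_mul, div_mul_eq_mul_div, eq_div_iff (hv x), hprop]
  refine ⟨g, fun x ↦ ?_, fun x hx ↦ h0' x (by rw [hg, hx, zero_smul]), hg⟩
  -- The vectors v y were chosen without continuity in y. Near x, proportionality allows g to be
  -- computed on fixed fields Z instead.
  obtain ⟨Z, hZ⟩ := exists_fields_apply_ne_zero h0 x
  have h1 : ContMDiffAt 𝓘(ℝ, E) 𝓘(ℝ, ℝ) ∞
      (fun y ↦ (η' y fun i ↦ Z i y) / (η y fun i ↦ Z i y)) x := (hη' Z x).div₀ (hη Z x) hZ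
  refine h1.congr_of_eventuallyEq ?_
  filter_upwards [(hη Z x).continuousAt.eventually_ne hZ] with y hy
  rw [hg y, AlternatingMap.smul_apply, smul_eq_mul, mul_div_cancel_right₀ _ hy]

variable {ν : ∀ x : M, Tan E M x [⋀^Fin q]→ₗ[ℝ] ℝ}

/-- Each transverse orientation of an involutive distribution has a Reeb form. -/
theorem exists_isReebForm (hD : IsRegularDist D r) (hrq : r + q = Module.finrank ℝ E)
    (hinv : ∀ X ∈ tangentFields D, ∀ Y ∈ tangentFields D, X.bracket Y ∈ tangentFields D)
    (hν : IsTransverseOrientation D q ν) : ∃ α : TangForm D, IsReebForm D ν α := by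
  have hkill (x : M) : KilledBy (D x) (ν x) := hν.vanish x
  -- L_X ν is killed by D: with V tangent to D in one slot, ν vanishes identically, and [X, V] is
  -- again tangent by involutivity. In degree codim D it is therefore proportional to ν.
  have hL (X : VF E M) (hX : X ∈ tangentFields D) (Y Z : Fin q → VF E M) (x : M) :
      lieDerivForm X ν Y x * (ν x fun i ↦ Z i x) = lieDerivForm X ν Z x * ν x fun i ↦ Y i x := by
    obtain ⟨g, hg⟩ := exists_lieDerivForm_eq hν.smooth X x
    have hgk : KilledBy (D x) g := by
      intro v i hv
      obtain ⟨V, hV, hVx⟩ := hD.exists_field x (v i) hv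
      choose W hW using fun j ↦ exists_VF_apply_eq x (v j)
      have h1 : (fun j ↦ Function.update W i V j x) = v := by
        rw [VF.update_apply, hVx]
        simp only [hW, Function.update_eq_self]
      have h2 := hg (Function.update W i V)
      rw [h1] at h2
      rw [← h2, lieDerivForm_update, hkill x _ i (by simpa using hinv X hX V hV x),
        Finset.sum_eq_zero, sub_zero, sub_zero]
      · have h3 : (fun y ↦ ν y (Function.update (fun j ↦ W j y) i (V y))) = fun _ ↦ 0 := by
          ext y
          exact hkill y _ i (by simpa using hV y)
        rw [h3, VF.deriv_zero]
      · intro j _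
        exact hkill x _ i (by simpa using hV x)
    rw [hg, hg]
    exact hgk.mul_comm_apply (hkill x)
      (by rw [Fintype.card_fin, hD.finrank_eq]; exact hrq) _ _
  -- Tensoriality in X uses that ν is killed by X. It makes the pointwise definition of the Reeb
  -- form below independent of the extension of the tangent vector.
  have hX (Y : Fin q → VF E M) (x : M) {X X' : VF E M} (hX : X ∈ tangentFields D)
      (hX' : X' ∈ tangentFields D) (h : X x = X' x) :
      lieDerivForm X ν Y x = lieDerivForm X' ν Y x :=
    hD.tensorial (A := ℝ)
      { toFun := fun X ↦ lieDerivForm X ν Y x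
        map_add' := fun _ _ ↦ add_lieDerivForm _ _ _ _
        map_smul' := fun _ _ ↦ smul_lieDerivForm _ _ _ _ } x
      (fun X hX h hh ↦ fmul_lieDerivForm
        (fun v i hv ↦ hkill x v i (hv ▸ hX x)) hh Y) hX hX' h
  choose Z hZ using fun x ↦ exists_fields_apply_ne_zero hν.nowhereZero x
  choose ext hext using fun x ↦ hD.exists_linear_extension x
  let a : LeafCovectors D := fun x ↦ (ν x fun i ↦ Z x i x)⁻¹ •
    { toFun := fun v ↦ lieDerivForm (ext x v) ν (Z x) x
      map_add' := fun v w ↦ by rw [map_add, add_lieDerivForm]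
      map_smul' := fun c v ↦ by rw [map_smul, smul_lieDerivForm]; rfl }
  have ha (X : tangentFields D) (Y : Fin q → VF E M) (x : M) :
      lieDerivForm X.1 ν Y x = leafEval a X x * ν x fun i ↦ Y i x := by
    have h1 : leafEval a X x = (ν x fun i ↦ Z x i x)⁻¹ * lieDerivForm X.1 ν (Z x) x := by
      rw [hX (Z x) x X.2 (hext x ⟨X.1 x, X.2 x⟩).1 (hext x ⟨X.1 x, X.2 x⟩).2.symm]
      rfl
    rw [h1, mul_assoc, ← hL X.1 X.2 Y (Z x) x]
    have := hZ x
    field_simp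
  refine ⟨⟨a, fun X x ↦ ?_⟩, ha⟩
  have h1 : ContMDiffAt 𝓘(ℝ, E) 𝓘(ℝ, ℝ) ∞
      (fun y ↦ lieDerivForm X.1 ν (Z x) y / (ν y fun i ↦ Z x i y)) x :=
    (hν.smooth.smooth_lieDerivForm X.1 (Z x) x).div₀ (hν.smooth (Z x) x) (hZ x)
  refine h1.congr_of_eventuallyEq ?_
  filter_upwards [(hν.smooth (Z x) x).continuousAt.eventually_ne (hZ x)] with y hy
  rw [ha, mul_div_cancel_right₀ _ hy]

/-- Reeb forms are closed. -/
theorem IsReebForm.mem_leafCocycles (hs : IsSmoothForm ν) (h0 : NowhereZero ν) {α : TangForm D}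
    (hinv : ∀ X ∈ tangentFields D, ∀ Y ∈ tangentFields D, X.bracket Y ∈ tangentFields D)
    (hα : IsReebForm D ν α) : α ∈ leafCocycles D := by
  intro X Y x hXY
  obtain ⟨Z, hZ⟩ := exists_fields_apply_ne_zero h0 x
  let n : (Fin q → VF E M) → M → ℝ := fun W y ↦ ν y fun i ↦ W i y
  have hn (W) : SmoothFun (E := E) (n W) := hs W
  have hlie (X : VF E M) (W : Fin q → VF E M) (y : M) : lieDerivForm X ν W y
      = X.deriv (n W) y - ∑ i, n (Function.update W i (X.bracket (W i))) y := by
    simp only [n, VF.update_apply]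
    rfl
  -- The terms of L_X L_Y ν with brackets in two different slots. They are symmetric in X and Y,
  -- hence disappear from the commutator.
  let S (X Y : VF E M) : ℝ := ∑ i, ∑ j ∈ Finset.univ.erase i,
    n (Function.update (Function.update Z i (Y.bracket (Z i))) j (X.bracket (Z j))) x
  have hS (X Y : VF E M) : S X Y = S Y X := by
    refine (Finset.sum_comm' (s' := fun j ↦ Finset.univ.erase j) (t' := Finset.univ) ?_).trans ?_
    · intro i j
      simp [eq_comm]
    · refine Finset.sum_congr rfl fun j _ ↦ Finset.sum_congr rfl fun i hi ↦ ?_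
      rw [Function.update_comm (Finset.ne_of_mem_erase hi)]
  -- The equation L_Y ν = α(Y) ν is differentiated along X, and L_X ν = α(X) ν is then applied to
  -- each family with one slot replaced by [Y, Z i].
  have key (X Y : tangentFields D) :
      leafEval α.1 Y x * X.1.deriv (n Z) x + n Z x * X.1.deriv (leafEval α.1 Y) x
        + leafEval α.1 X x * Y.1.deriv (n Z) x - leafEval α.1 X x * leafEval α.1 Y x * n Z x
      = X.1.deriv (Y.1.deriv (n Z)) x
        - ∑ i, n (Function.update Z i (X.1.bracket (Y.1.bracket (Z i)))) x - S X.1 Y.1 := by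
    have h1 : (fun y ↦ leafEval α.1 Y y * n Z y) = fun y ↦ Y.1.deriv (n Z) y
        - ∑ i, n (Function.update Z i (Y.1.bracket (Z i))) y := by
      ext y
      rw [← hlie]
      exact (hα Y Z y).symm
    have h2 := X.1.deriv_mul (α.2 Y) (hn Z) x
    rw [h1, VF.deriv_sub _ (Y.1.smooth_deriv (hn Z)) (smoothFun_sum fun _ _ ↦ hn _),
      VF.deriv_sum _ _ fun i ↦ hn _] at h2
    have h3 (i : Fin q) : X.1.deriv (n (Function.update Z i (Y.1.bracket (Z i)))) x
        = leafEval α.1 X x * n (Function.update Z i (Y.1.bracket (Z i))) x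
          + n (Function.update Z i (X.1.bracket (Y.1.bracket (Z i)))) x
          + ∑ j ∈ Finset.univ.erase i, n (Function.update
            (Function.update Z i (Y.1.bracket (Z i))) j (X.1.bracket (Z j))) x := by
      have e1 := (hlie X.1 (Function.update Z i (Y.1.bracket (Z i))) x).symm.trans (hα X _ x)
      rw [← Finset.add_sum_erase _ _ (Finset.mem_univ i), Function.update_self,
        Function.update_idem] at e1
      have e2 : ∑ j ∈ Finset.univ.erase i, n (Function.update
            (Function.update Z i (Y.1.bracket (Z i))) j
            (X.1.bracket (Function.update Z i (Y.1.bracket (Z i)) j))) x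
          = ∑ j ∈ Finset.univ.erase i, n (Function.update
            (Function.update Z i (Y.1.bracket (Z i))) j (X.1.bracket (Z j))) x :=
        Finset.sum_congr rfl fun j hj ↦ by
          rw [Function.update_of_ne (Finset.ne_of_mem_erase hj) (Y.1.bracket (Z i)) Z]
      rw [e2] at e1
      change _ = leafEval α.1 X x * n (Function.update Z i (Y.1.bracket (Z i))) x at e1
      linarith
    simp only [h3, Finset.sum_add_distrib, ← Finset.mul_sum] at h2
    have h4 := congrFun h1 x
    change _ = _ - _ - ∑ i, ∑ j ∈ Finset.univ.erase i, _
    linear_combination -h2 - leafEval α.1 X x * h4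
  have hZb (i : Fin q) : n (Function.update Z i ((X.1.bracket Y.1).bracket (Z i))) x
      = n (Function.update Z i (X.1.bracket (Y.1.bracket (Z i)))) x
        - n (Function.update Z i (Y.1.bracket (X.1.bracket (Z i)))) x := by
    have hl : (X.1.bracket Y.1).bracket (Z i) x
        = X.1.bracket (Y.1.bracket (Z i)) x - Y.1.bracket (X.1.bracket (Z i)) x := by
      rw [X.1.leibniz_bracket Y.1 (Z i)]
      exact (add_sub_cancel_right _ _).symm
    simp only [n, VF.update_apply, hl, AlternatingMap.map_update_sub]
  have h1 := key X Y
  have h2 := key Y X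
  rw [hS] at h2
  have h3 := (hlie (X.1.bracket Y.1) Z x).symm.trans
    (hα ⟨_, hinv X.1 X.2 Y.1 Y.2⟩ Z x)
  simp only [hZb, Finset.sum_sub_distrib] at h3
  rw [VF.bracket_deriv _ _ (hn Z)] at h3
  have h4 : leafEval α.1 ⟨_, hinv X.1 X.2 Y.1 Y.2⟩ x = α.1 x ⟨X.1.bracket Y.1 x, hXY⟩ := rfl
  rw [h4] at h3
  change _ = _ * n Z x at h3
  refine (mul_eq_zero.1 (?_ : leafD α X Y x hXY * n Z x = 0)).resolve_right hZ
  rw [leafD]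
  -- Antisymmetrizing leaves (X.α(Y) - Y.α(X)) ν = L_[X,Y] ν = α([X, Y]) ν, evaluated on Z.
  linear_combination h1 - h2 + h3

omit [T2Space M] in
/-- The Reeb form of `gν` is `α + d_𝓕 log |g|`. -/
theorem IsReebForm.mul (hs : IsSmoothForm ν) {α : TangForm D} (hα : IsReebForm D ν α) {g : M → ℝ}
    (hg : SmoothFun (E := E) g) (h0 : ∀ x, g x ≠ 0) :
    IsReebForm D (fun x ↦ g x • ν x) (α + leafDiff D (smoothFun_log hg h0)) := by
  intro X Y x
  rw [lieDerivForm_mul hs X.1 hg, hα X Y x, leafEval_add, leafEval_leafDiff,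
    ← X.1.deriv_log hg x (h0 x), AlternatingMap.smul_apply, smul_eq_mul]
  ring

/-- The Reeb class of a closed Reeb form. -/
theorem isReebClass_leafClass (hD : IsRegularDist D r) (hrq : r + q = Module.finrank ℝ E)
    (hν : IsTransverseOrientation D q ν) (α : leafCocycles D) (hα : IsReebForm D ν α.1) :
    IsReebClass D q (leafClass α) := by
  refine ⟨⟨ν, hν⟩, fun ν' hν' ↦ ?_⟩
  obtain ⟨g, hg, h0, hgν⟩ := exists_eq_fmul (D := D) (fun x ↦ by rw [hD.finrank_eq, hrq])
    hν.smooth hν'.smooth hν.nowhereZero hν'.nowhereZero hν.vanish hν'.vanish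
  have hlog := smoothFun_log hg h0
  refine ⟨⟨α.1 + leafDiff D hlog, add_mem α.2 (leafDiff_mem_cocycles hlog)⟩, ?_, ?_⟩
  · rw [(funext hgν : ν' = fun x ↦ g x • ν x)]
    exact hα.mul hν.smooth hg h0
  · refine (Submodule.Quotient.eq _).2 ?_
    change α.1 + leafDiff D hlog - α.1 ∈ leafCoboundaries D
    rw [add_sub_cancel_left]
    exact leafDiff_mem_coboundaries hlog

end ReebForm

/-! ### The Liouville volume form -/

section Volume

variable {E : Type*} [NormedAddCommGroup E] [NormedSpace ℝ E] [FiniteDimensional ℝ E]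
  {M : Type*} [TopologicalSpace M] [ChartedSpace E M] [IsManifold 𝓘(ℝ, E) ∞ M]

/-- A form of top degree is smooth if it is smooth and nonzero on local frames. -/
theorem isSmoothForm_of_frame [T2Space M]
    {μ : ∀ x : M, Tan E M x [⋀^Fin (Module.finrank ℝ E)]→ₗ[ℝ] ℝ}
    (h : ∀ x, ∃ Y : Fin (Module.finrank ℝ E) → VF E M,
      SmoothFun (E := E) (fun y ↦ μ y fun i ↦ Y i y) ∧ (μ x fun i ↦ Y i x) ≠ 0) :
    IsSmoothForm μ := by
  intro Y' x
  obtain ⟨Y, hY, hYx⟩ := h x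
  obtain ⟨e, F, he, -, hdet⟩ := (isRegularDist_top (E := E) (M := M)).exists_frame x
  -- The wedge of the differentials of the e i is a smooth reference form, so near x one has μ(Y') =
  -- μ(Y) η(Y') / η(Y), a quotient of smooth functions.
  let η : ∀ y : M, Tan E M y [⋀^Fin (Module.finrank ℝ E)]→ₗ[ℝ] ℝ := fun y ↦
    (Pi.basisFun ℝ (Fin (Module.finrank ℝ E))).det.compLinearMap
      (LinearMap.pi fun i ↦ dfun E (e i) y)
  have hη (y : M) (v : Fin (Module.finrank ℝ E) → Tan E M y) :
      η y v = (Matrix.of fun i j ↦ dfun E (e j) y (v i)).det :=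
    Pi.basisFun_det_apply _
  have hηs (W : Fin (Module.finrank ℝ E) → VF E M) :
      SmoothFun (E := E) fun y ↦ η y fun i ↦ W i y := by
    simp only [hη]
    exact smoothFun_det fun i j ↦ (W i).smooth_deriv (he j)
  have hprop (y : M) (v w) : μ y v * η y w = μ y w * η y v :=
    (killedBy_bot (μ y)).mul_comm_apply (killedBy_bot (η y))
      (by rw [finrank_bot, Fintype.card_fin, zero_add]; rfl) v w
  have hηF : (η x fun j ↦ F j x) ≠ 0 := by
    rw [hη, ← Matrix.det_transpose]
    exact hdet
  have hηY : (η x fun i ↦ Y i x) ≠ 0 := fun h0 ↦ by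
    have := hprop x (fun j ↦ F j x) (fun i ↦ Y i x)
    rw [h0, mul_zero] at this
    exact mul_ne_zero hYx hηF this.symm
  have h1 : ContMDiffAt 𝓘(ℝ, E) 𝓘(ℝ, ℝ) ∞
      (fun y ↦ ((μ y fun i ↦ Y i y) * (η y fun i ↦ Y' i y)) / (η y fun i ↦ Y i y)) x :=
    ((hY x).mul (hηs Y' x)).div₀ (hηs Y x) hηY
  refine h1.congr_of_eventuallyEq ?_
  filter_upwards [(hηs Y x).continuousAt.eventually_ne hηY] with y hy
  rw [eq_div_iff hy, hprop]

namespace PoissonTensor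

variable (π : PoissonTensor E M) {p q : ℕ}

omit [IsManifold 𝓘(ℝ, E) ∞ M] in
theorem ker_ofBidual_comp {x : M} (W : Cot E M x →ₗ[ℝ] Cot E M x →ₗ[ℝ] ℝ) :
    LinearMap.ker (ofBidual.toLinearMap ∘ₗ W) = LinearMap.ker W :=
  LinearEquiv.ker_comp _ _

theorem killedBy_ker_sharp (x : M) : KilledBy (LinearMap.ker (π.sharp x)) (pfaff p (π.toFun x)) := by
  rw [sharp, ker_ofBidual_comp]
  exact killedBy_pfaff p (π.alt x)

theorem pfaff_ne_zero {x : M} (hr : Module.finrank ℝ (π.dist x) = 2 * p) :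
    pfaff p (π.toFun x) ≠ 0 := by
  have h : Module.finrank ℝ (LinearMap.range (π.toFun x)) = 2 * p := by
    rw [← hr, dist, sharp, LinearMap.range_comp]
    exact (LinearEquiv.finrank_map_eq ofBidual _).symm
  obtain ⟨v, hv⟩ := exists_isSymplecticFamily (π.alt x) p h.ge
  exact fun h0 ↦ hv.pfaff_ne_zero (by rw [h0]; rfl)

omit [FiniteDimensional ℝ E] in
omit [FiniteDimensional ℝ E] in
theorem smooth_pfaff {f : Fin p × Fin 2 → M → ℝ} (hf : ∀ a, SmoothFun (E := E) (f a)) :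
    SmoothFun (E := E) fun y ↦ pfaff p (π.toFun y) fun a ↦ dfun E (f a) y := by
  simp only [pfaff_apply]
  exact smoothFun_sum fun σ _ ↦ contMDiff_const.mul
    (smoothFun_prod fun k _ ↦ π.smooth_apply_dfun (hf _) (hf _))

variable [T2Space M]

/-- Hamiltonian vector fields are derivations of the Poisson bracket. -/
theorem ham_deriv_apply_dfun {f g h : M → ℝ} (hf : SmoothFun (E := E) f)
    (hg : SmoothFun (E := E) g) (hh : SmoothFun (E := E) h) (x : M) :
    (π.ham hf).deriv (fun y ↦ π.toFun y (dfun E g y) (dfun E h y)) x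
      = π.toFun x (dfun E (fun y ↦ π.toFun y (dfun E f y) (dfun E g y)) x) (dfun E h x)
        + π.toFun x (dfun E g x) (dfun E (fun y ↦ π.toFun y (dfun E f y) (dfun E h y)) x) := by
  have e : (fun y ↦ π.toFun y (dfun E h y) (dfun E f y))
      = fun y ↦ -1 * π.toFun y (dfun E f y) (dfun E h y) := by
    ext y
    rw [π.skew]
    ring
  have hj := π.jacobi f g h hf hg hh x
  rw [e, dfun_const_mul _ (π.smooth_apply_dfun hf hh), map_smul, smul_eq_mul] at hj
  rw [ham_deriv, π.skew _ (dfun E h x)]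
  linarith

/-- Hamiltonian vector fields are derivations of the Liouville form. -/
theorem ham_deriv_pfaff {f : M → ℝ} (hf : SmoothFun (E := E) f) {g : Fin p × Fin 2 → M → ℝ}
    (hg : ∀ a, SmoothFun (E := E) (g a)) (x : M) :
    (π.ham hf).deriv (fun y ↦ pfaff p (π.toFun y) fun a ↦ dfun E (g a) y) x
      = ∑ a, pfaff p (π.toFun x) (Function.update (fun a ↦ dfun E (g a) x) a
          (dfun E (fun y ↦ π.toFun y (dfun E f y) (dfun E (g a) y)) x)) := by
  simp only [pfaff_apply]
  have hs (a b) := π.smooth_apply_dfun (hg a) (hg b)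
  have hs' (σ : Equiv.Perm (Fin p × Fin 2)) : SmoothFun (E := E) fun y ↦
      ((Equiv.Perm.sign σ : ℤ) : ℝ)
        * ∏ k, π.toFun y (dfun E (g (σ (k, 0))) y) (dfun E (g (σ (k, 1))) y) :=
    contMDiff_const.mul (smoothFun_prod fun k _ ↦ hs _ _)
  rw [VF.deriv_sum _ _ hs', Finset.sum_comm]
  refine Finset.sum_congr rfl fun σ _ ↦ ?_
  rw [VF.deriv_const_mul _ _ (smoothFun_prod fun k _ ↦ hs _ _),
    VF.deriv_prod _ _ fun k ↦ hs _ _, ← Finset.mul_sum, ← Equiv.sum_comp σ, Fintype.sum_prod_type]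
  congr 1
  refine Finset.sum_congr rfl fun k _ ↦ ?_
  have h (i : Fin 2) (z : Cot E M x) :
      ∏ l, π.toFun x (Function.update (fun a ↦ dfun E (g a) x) (σ (k, i)) z (σ (l, 0)))
          (Function.update (fun a ↦ dfun E (g a) x) (σ (k, i)) z (σ (l, 1)))
        = π.toFun x (Function.update (fun b ↦ dfun E (g (σ b)) x) (k, i) z (k, 0))
          (Function.update (fun b ↦ dfun E (g (σ b)) x) (k, i) z (k, 1))
          * ∏ l ∈ Finset.univ.erase k,
            π.toFun x (dfun E (g (σ (l, 0))) x) (dfun E (g (σ (l, 1))) x) := by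
    rw [← prod_apply_update]
    have hu (b) : Function.update (fun a ↦ dfun E (g a) x) (σ (k, i)) z (σ b)
        = Function.update (fun b ↦ dfun E (g (σ b)) x) (k, i) z b := by
      simp only [Function.update_apply, σ.injective.eq_iff]
    simp only [hu]
  rw [Fin.sum_univ_two, h, h, π.ham_deriv_apply_dfun hf (hg _) (hg _)]
  simp [add_mul]

variable {ν : ∀ x : M, Tan E M x [⋀^Fin q]→ₗ[ℝ] ℝ}

/-- The Liouville volume form of a transversally oriented regular Poisson manifold. Its Lie
derivatives along Hamiltonian vector fields are given by the Reeb form. -/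
theorem exists_isVolumeForm (hr : ∀ x : M, Module.finrank ℝ (π.dist x) = 2 * p)
    (hpq : 2 * p + q = Module.finrank ℝ E) (hν : IsTransverseOrientation π.dist q ν)
    {α : TangForm π.dist} (hα : IsReebForm π.dist ν α) :
    ∃ μ : ∀ x : M, Tan E M x [⋀^Fin (Module.finrank ℝ E)]→ₗ[ℝ] ℝ, IsVolumeForm μ ∧
      ∀ (f : M → ℝ) (hf : SmoothFun (E := E) f) (Y : Fin (Module.finrank ℝ E) → VF E M) (x : M),
        lieDerivForm (π.ham hf) μ Y x
          = leafEval α.1 (π.sharpTangent (OneForm.ofFun f hf)) x * μ x fun i ↦ Y i x := by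
  have hcard : Fintype.card (Fin p × Fin 2) + Fintype.card (Fin q) = Module.finrank ℝ E := by
    simp only [Fintype.card_prod, Fintype.card_fin]
    omega
  let e : Fin (Module.finrank ℝ E) ≃ (Fin p × Fin 2) ⊕ Fin q :=
    Fintype.equivOfCardEq (by rw [Fintype.card_fin, Fintype.card_sum, hcard])
  -- Here s is π at x and F is the Pfaffian. The prescription is consistent because F is killed by
  -- the kernel of π and ν by its image.
  choose μ hμ using fun x ↦ exists_alternatingMap_sumElim (π.killedBy_ker_sharp (p := p) x)
    (hν.vanish x : KilledBy (LinearMap.range (π.sharp x)) (ν x)) (π.pfaff_ne_zero (hr x))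
    (hν.nowhereZero x)
    ((hr x).trans (by simp only [Fintype.card_prod, Fintype.card_fin]; omega)) hcard e
  have hframe (x : M) : ∃ (g : Fin p × Fin 2 → M → ℝ) (_ : ∀ a, SmoothFun (E := E) (g a))
      (Z : Fin q → VF E M), pfaff p (π.toFun x) (fun a ↦ dfun E (g a) x) ≠ 0 ∧
        (ν x fun j ↦ Z j x) ≠ 0 := by
    obtain ⟨b, hb⟩ := DFunLike.ne_iff.1 (π.pfaff_ne_zero (hr x))
    obtain ⟨Z, hZ⟩ := exists_fields_apply_ne_zero hν.nowhereZero x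
    choose g hg hgb using fun a ↦ exists_smoothFun_dfun_eq x (b a)
    exact ⟨g, hg, Z, by simp only [hgb]; exact hb, hZ⟩
  let Y (g : Fin p × Fin 2 → M → ℝ) (hg : ∀ a, SmoothFun (E := E) (g a)) (Z : Fin q → VF E M) :
      (Fin p × Fin 2) ⊕ Fin q → VF E M := Sum.elim (fun a ↦ π.ham (hg a)) Z
  have hY (g) (hg : ∀ a, SmoothFun (E := E) (g a)) (Z : Fin q → VF E M) (y : M) :
      (fun s ↦ Y g hg Z s y)
        = Sum.elim (fun a ↦ π.sharp y (dfun E (g a) y)) fun j ↦ Z j y := by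
    ext (a | j) <;> rfl
  have hμY (g) (hg : ∀ a, SmoothFun (E := E) (g a)) (Z : Fin q → VF E M) (y : M) :
      (μ y fun i ↦ Y g hg Z (e i) y)
        = pfaff p (π.toFun y) (fun a ↦ dfun E (g a) y) * ν y fun j ↦ Z j y := by
    rw [← hμ, ← hY g hg]
    rfl
  have hsm : IsSmoothForm μ := isSmoothForm_of_frame fun x ↦ by
    obtain ⟨g, hg, Z, h1, h2⟩ := hframe x
    refine ⟨fun i ↦ Y g hg Z (e i), ?_, ?_⟩
    · simp only [hμY]
      exact (π.smooth_pfaff hg).mul (hν.smooth Z)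
    · rw [hμY]
      exact mul_ne_zero h1 h2
  refine ⟨μ, ⟨hsm, fun x hx ↦ ?_⟩, fun f hf Y' x ↦ ?_⟩
  · obtain ⟨g, hg, Z, h1, h2⟩ := hframe x
    have h3 := hμY g hg Z x
    rw [hx] at h3
    exact mul_ne_zero h1 h2 h3.symm
  · obtain ⟨g, hg, Z, h1, h2⟩ := hframe x
    obtain ⟨L, hL⟩ := exists_lieDerivForm_eq hsm (π.ham hf) x
    have h0 : (μ x fun i ↦ Y g hg Z (e i) x) ≠ 0 := by
      rw [hμY]
      exact mul_ne_zero h1 h2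
    have hprop := (killedBy_bot L).mul_comm_apply (killedBy_bot (μ x))
      (by rw [finrank_bot, Fintype.card_fin, zero_add]; rfl)
      (fun i ↦ Y' i x) (fun i ↦ Y g hg Z (e i) x)
    rw [← hL Y', ← hL fun i ↦ Y g hg Z (e i)] at hprop
    refine mul_right_cancel₀ h0 (hprop.trans ?_)
    -- L_{π(df)} μ and μ are both of top degree at x, so comparing them on one frame of Hamiltonian
    -- fields and transverse fields Z suffices.
    suffices key : lieDerivForm (π.ham hf) μ (fun i ↦ Y g hg Z (e i)) x
        = leafEval α.1 (π.sharpTangent (OneForm.ofFun f hf)) x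
          * μ x fun i ↦ Y g hg Z (e i) x by
      rw [key]
      ring
    have hupd (s : (Fin p × Fin 2) ⊕ Fin q) (v : Tan E M x) :
        Function.update (fun i ↦ Y g hg Z (e i) x) (e.symm s) v
          = Function.update (Sum.elim (fun a ↦ π.sharp x (dfun E (g a) x)) fun j ↦ Z j x) s v
            ∘ e := by
      rw [Function.update_comp_equiv, ← hY g hg]
      rfl
    -- In the Hamiltonian slots the bracket replaces g a by {f, g a}, which gives exactly the
    -- derivative of the Pfaffian and cancels it. The transverse slots leave Pf times L_{π(df)} ν.
    have hsum : ∑ i, μ x (Function.update (fun j ↦ Y g hg Z (e j) x) i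
          ((π.ham hf).bracket (Y g hg Z (e i)) x))
        = (∑ a, pfaff p (π.toFun x) (Function.update (fun a ↦ dfun E (g a) x) a
            (dfun E (fun y ↦ π.toFun y (dfun E f y) (dfun E (g a) y)) x))) * (ν x fun j ↦ Z j x)
          + pfaff p (π.toFun x) (fun a ↦ dfun E (g a) x)
            * ∑ j, ν x (Function.update (fun j ↦ Z j x) j ((π.ham hf).bracket (Z j) x)) := by
      rw [← Equiv.sum_comp e.symm, Fintype.sum_sum_type, Finset.sum_mul, Finset.mul_sum]
      simp only [hupd, Equiv.apply_symm_apply]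
      congr 1
      · refine Finset.sum_congr rfl fun a _ ↦ ?_
        have hb : (π.ham hf).bracket (Y g hg Z (Sum.inl a)) x
            = π.sharp x (dfun E (fun y ↦ π.toFun y (dfun E f y) (dfun E (g a) y)) x) := by
          change (π.ham hf).bracket (π.ham (hg a)) x = _
          rw [bracket_ham]
          rfl
        rw [hb, ← hμ]
        congr 2
        ext (b | j)
        · by_cases h : b = a
          · subst h; simp
          · simp [h]
        · simp
      · refine Finset.sum_congr rfl fun j _ ↦ ?_
        rw [← hμ]
        congr 2
        ext (b | l)
        · simp
        · by_cases h : l = j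
          · subst h; simp [Y]
          · simp [h]
    have hν' := hα (π.sharpTangent (OneForm.ofFun f hf)) Z x
    change lieDerivForm (π.ham hf) ν Z x = _ at hν'
    rw [lieDerivForm] at hν' ⊢
    rw [hsum]
    simp only [hμY]
    rw [VF.deriv_mul _ (π.smooth_pfaff hg) (hν.smooth Z), π.ham_deriv_pfaff hf hg]
    linear_combination pfaff p (π.toFun x) (fun a ↦ dfun E (g a) x) * hν'

end PoissonTensor

end Volume

/-! ### The modular class -/

section ModularClass

variable {E : Type*} [NormedAddCommGroup E] [NormedSpace ℝ E] [FiniteDimensional ℝ E]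
  {M : Type*} [TopologicalSpace M] [T2Space M] [ChartedSpace E M] [IsManifold 𝓘(ℝ, E) ∞ M]
  (π : PoissonTensor E M) {p q : ℕ} {ν : ∀ x : M, Tan E M x [⋀^Fin q]→ₗ[ℝ] ℝ}

/-- The modular class is the image of the class of a closed Reeb form. -/
theorem PoissonTensor.isModularClass_pushH1
    (hr : ∀ x : M, Module.finrank ℝ (π.dist x) = 2 * p) (hpq : 2 * p + q = Module.finrank ℝ E)
    (hν : IsTransverseOrientation π.dist q ν) (α : leafCocycles π.dist)
    (hα : IsReebForm π.dist ν α.1) : π.IsModularClass (π.pushH1 (leafClass α)) := by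
  obtain ⟨μ₀, hμ₀, hL⟩ := π.exists_isVolumeForm hr hpq hν hα
  refine ⟨⟨μ₀, hμ₀⟩, fun μ hμ ↦ ?_⟩
  obtain ⟨g, hg, h0, hgμ⟩ := exists_eq_fmul (D := fun _ ↦ ⊥)
    (fun x ↦ by rw [finrank_bot, zero_add]) hμ₀.1 hμ.1 hμ₀.2 hμ.2
    (fun x ↦ killedBy_bot _) (fun x ↦ killedBy_bot _)
  have hlog := smoothFun_log hg h0
  -- The volume form gμ₀ has modular field π(α + d_𝓕 log|g|), since π(df).log|g| is the value of d_𝓕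
  -- log|g| on π(df). The correction is exact on the leaves, so the class is that of α.
  let α' : leafCocycles π.dist :=
    ⟨α.1 + leafDiff π.dist hlog, add_mem α.2 (leafDiff_mem_cocycles hlog)⟩
  refine ⟨⟨π.push α'.1, π.push_mem_cocycles α'.2⟩, fun f hf Y x ↦ ?_, ?_⟩
  · rw [(funext hgμ : μ = fun x ↦ g x • μ₀ x)]
    change lieDerivForm (π.ham hf) _ Y x = (π.push α'.1).deriv f x * _
    rw [lieDerivForm_mul hμ₀.1 _ hg, hL, π.push_deriv α'.1 f hf, leafEval_add, leafEval_leafDiff,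
      ← (π.ham hf).deriv_log hg x (h0 x), AlternatingMap.smul_apply, smul_eq_mul]
    change _ = (_ + (π.ham hf).deriv _ x) * _
    ring
  · rw [← π.pushH1_leafClass]
    congr 1
    refine (Submodule.Quotient.eq _).2 ?_
    change α.1 + leafDiff π.dist hlog - α.1 ∈ leafCoboundaries π.dist
    rw [add_sub_cancel_left]
    exact leafDiff_mem_coboundaries hlog

end ModularClass

end RegularPoisson

end

/-! ### The main theorem -/

open RegularPoisson in
theorem theorem4p1 {E : Type*} [NormedAddCommGroup E] [NormedSpace ℝ E] [FiniteDimensional ℝ E]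
    {P : Type*} [TopologicalSpace P] [T2Space P] [SigmaCompactSpace P] [ChartedSpace E P]
    [IsManifold 𝓘(ℝ, E) ∞ P] (π : PoissonTensor E P) (p q : ℕ)
    (hrank : ∀ x : P, Module.finrank ℝ (π.dist x) = 2 * p)
    (hcodim : 2 * p + q = Module.finrank ℝ E)
    (hor : ∃ ν : ∀ x : P, Tan E P x [⋀^Fin q]→ₗ[ℝ] ℝ, IsTransverseOrientation π.dist q ν) :
    (∀ X ∈ tangentFields π.dist, ∀ Y ∈ tangentFields π.dist,
      X.bracket Y ∈ tangentFields π.dist) ∧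
    (∀ (α : TangForm π.dist) (x : P) (a : Cot E P x), π.sharp x a = 0 → a (π.push α x) = 0) ∧
    ∃ Φ : LeafH1 π.dist →ₗ[ℝ] π.H1,
      (∀ α : leafCocycles π.dist, ∃ h : π.push α.1 ∈ π.cocycles,
        Φ (leafClass α) = π.cohomClass ⟨π.push α.1, h⟩) ∧
      Function.Injective Φ ∧
      ∃ (R : LeafH1 π.dist) (m : π.H1),
        IsReebClass π.dist q R ∧ π.IsModularClass m ∧ Φ R = m := by
  have hD := π.isRegularDist hrank
  have hinv : ∀ X ∈ tangentFields π.dist, ∀ Y ∈ tangentFields π.dist,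
      X.bracket Y ∈ tangentFields π.dist := fun X hX Y hY ↦ π.bracket_mem hrank hX hY
  obtain ⟨ν, hν⟩ := hor
  obtain ⟨α, hα⟩ := exists_isReebForm hD hcodim hinv hν
  let α' : leafCocycles π.dist := ⟨α, hα.mem_leafCocycles hν.smooth hν.nowhereZero hinv⟩
  refine ⟨hinv, fun α x a ha ↦ ?_, π.pushH1, fun α ↦ ⟨π.push_mem_cocycles α.2, rfl⟩,
    π.pushH1_injective, leafClass α', π.pushH1 (leafClass α'),
    isReebClass_leafClass hD hcodim hν α' hα, π.isModularClass_pushH1 hrank hcodim hν α' hα, rfl⟩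
  rw [π.apply_push]
  simp only [ha]
  exact map_zero (α.1 x)
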